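/- **Theorem (PBW theorem for symplectic reflection algebras).** Let $V$ be a finite dimensional complex vector space with a symplectic form $\omega$ (a nondegenerate alternating bilinear form), and let $G$ be a finite group acting on $V$ linearly and faithfully and preserving $\omega$. Assume that $(\wedge^2V)^G=\mathbb{C}\omega$ under the identification $V\cong V^*$ given by $\omega$, that is, every $G$-invariant alternating bilinear form on $V$ is a scalar multiple of $\omega$. Let $S\subset G$ be the set of symplectic reflections, that is, of the elements $s\in G$ such that $s-1$ has rank $2$ on $V$. For $s\in S$ let $\omega_s(x,y)$ be the form $\omega$ applied to the projections of $x,y\in V$ to the image of $1-s$ along the kernel of $1-s$. Let $\kappa:\wedge^2V\to\mathbb{C}[G]$ be a linear $G$-equivariant map, where $G$ acts on $\mathbb{C}[G]$ by conjugation, and write $\kappa(x,y)=\kappa(x\wedge y)$. Let $\mathbb{C}[G]\ltimes T(V)$ be the semidirect product of $\mathbb{C}[G]$ with the tensor algebra of $V$, so that $gx=g(x)g$ for $g\in G$ and $x\in V$, and let $H_\kappa$ be its quotient by the two-sided ideal generated by the elements $xy-yx-\kappa(x,y)$, $x,y\in V$. Let $F_n\subset H_\kappa$ be the span of the products $x_1\cdots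 x_kg$ with $k\le n$, $x_i\in V$, $g\in G$; this is the increasing filtration of $H_\kappa$ with $\deg V=1$ and $\deg G=0$. Let $\operatorname{gr}H_\kappa=\bigoplus_{n\ge0}F_n/F_{n-1}$ (with $F_{-1}=0$) be the associated graded algebra, and let $\xi:\mathbb{C}[G]\ltimes SV\to\operatorname{gr}H_\kappa$ be the natural algebra homomorphism, which sends $x\in V$ to its class in $F_1/F_0$ and $g\in G$ to its class in $F_0$. Then $\xi$ is surjective, and $\xi$ is an isomorphism if and only if there are $t\in\mathbb{C}$ and a function $c:S\to\mathbb{C}$, invariant under conjugation by $G$, such that $$\kappa(x,y)=t\,\omega(x,y)-2\sum_{s\in S}c_s\,\omega_s(x,y)\,s\qquad\text{for all }x,y\in V.$$ -/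

import Mathlib

open scoped DirectSum

noncomputable section

/-! ### The associated graded algebra of a filtered algebra -/

namespace AssocGraded

section

variable {A : Type*} [Ring A] [Algebra ℂ A] (F : ℕ → Submodule ℂ A)

/-- `F_{<n}`, the sum of the `F_m` with `m < n` (so `F_{<0} = 0`, and `F_{<n+1} = F_n` for an
increasing filtration). -/
def below (n : ℕ) : Submodule ℂ A := ⨆ m, ⨆ _ : m < n, F m

/-- The `n`-th piece `F_n / F_{<n}` of the associated graded space. -/
def Piece (n : ℕ) : Type _ := F n ⧸ (below F n).submoduleOf (F n)

instance (n : ℕ) : AddCommGroup (Piece F n) :=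
  inferInstanceAs (AddCommGroup (F n ⧸ (below F n).submoduleOf (F n)))

instance (n : ℕ) : Module ℂ (Piece F n) :=
  inferInstanceAs (Module ℂ (F n ⧸ (below F n).submoduleOf (F n)))

/-- The quotient map `F_n → F_n / F_{<n}`. -/
def cls (n : ℕ) : F n →ₗ[ℂ] Piece F n := ((below F n).submoduleOf (F n)).mkQ

theorem cls_surjective (n : ℕ) : Function.Surjective (cls F n) :=
  Submodule.mkQ_surjective _

theorem cls_eq_iff {n : ℕ} {a b : F n} :
    cls F n a = cls F n b ↔ (a : A) - (b : A) ∈ below F n :=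
  Submodule.Quotient.eq ((below F n).submoduleOf (F n))

theorem cls_eq_zero_iff {n : ℕ} {a : F n} : cls F n a = 0 ↔ (a : A) ∈ below F n := by
  rw [← map_zero (cls F n), cls_eq_iff]
  simp

theorem mem_below {m n : ℕ} (h : m < n) {a : A} (ha : a ∈ F m) : a ∈ below F n :=
  Submodule.mem_iSup_of_mem m (Submodule.mem_iSup_of_mem h ha)

theorem mk_cls_eq {m n : ℕ} (h : m = n) {a : F m} {b : F n} (hab : (a : A) = b) :
    GradedMonoid.mk m (cls F m a) = GradedMonoid.mk n (cls F n b) := by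
  subst h
  rw [Subtype.ext hab]

variable [SetLike.GradedMonoid F]

theorem below_mul {m n : ℕ} {a b : A} (ha : a ∈ below F m) (hb : b ∈ F n) :
    a * b ∈ below F (m + n) := by
  have h : below F m ≤ (below F (m + n)).comap (LinearMap.mulRight ℂ b) :=
    iSup_le fun k => iSup_le fun hk x hx =>
      mem_below F (Nat.add_lt_add_right hk n) (SetLike.mul_mem_graded hx hb)
  exact h ha

theorem mul_below {m n : ℕ} {a b : A} (ha : a ∈ F m) (hb : b ∈ below F n) :
    a * b ∈ below F (m + n) := by
  have h : below F n ≤ (below F (m + n)).comap (LinearMap.mulLeft ℂ a) :=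
    iSup_le fun k => iSup_le fun hk x hx =>
      mem_below F (Nat.add_lt_add_left hk m) (SetLike.mul_mem_graded ha hx)
  exact h hb

/-- `(a, b) ↦` the class of `a b`. -/
def mulAux (m n : ℕ) : F m →ₗ[ℂ] F n →ₗ[ℂ] Piece F (m + n) :=
  LinearMap.mk₂ ℂ (fun a b => cls F (m + n) ⟨a * b, SetLike.mul_mem_graded a.2 b.2⟩)
    (fun a a' b => by rw [← map_add]; congr 1; ext; simp [add_mul])
    (fun c a b => by rw [← map_smul]; congr 1; ext; simp)
    (fun a b b' => by rw [← map_add]; congr 1; ext; simp [mul_add])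
    (fun c a b => by rw [← map_smul]; congr 1; ext; simp)

/-- The multiplication `gr_m × gr_n → gr_{m+n}` induced by the multiplication of `A`. -/
def mul (m n : ℕ) : Piece F m →ₗ[ℂ] Piece F n →ₗ[ℂ] Piece F (m + n) :=
  Submodule.liftQ _
    (LinearMap.flip (Submodule.liftQ ((below F n).submoduleOf (F n)) (mulAux F m n).flip (by
      intro b hb
      ext a
      exact (cls_eq_zero_iff F).2 (mul_below F a.2 hb))))
    (by
      intro a ha
      refine LinearMap.ext fun b => ?_
      obtain ⟨b, rfl⟩ := cls_surjective F n b
      exact (cls_eq_zero_iff F).2 (below_mul F ha b.2))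

theorem mul_cls (m n : ℕ) (a : F m) (b : F n) :
    mul F m n (cls F m a) (cls F n b) =
      cls F (m + n) ⟨a * b, SetLike.mul_mem_graded a.2 b.2⟩ := rfl

instance : GradedMonoid.GMul (Piece F) where
  mul {m n} a b := mul F m n a b

instance : GradedMonoid.GOne (Piece F) where
  one := cls F 0 ⟨1, SetLike.GradedOne.one_mem⟩

theorem gmul_def {m n : ℕ} (a : Piece F m) (b : Piece F n) :
    GradedMonoid.GMul.mul a b = mul F m n a b := rfl

theorem gone_def : (GradedMonoid.GOne.one : Piece F 0) = cls F 0 ⟨1, SetLike.GradedOne.one_mem⟩ :=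
  rfl

instance : DirectSum.GRing (Piece F) where
  mul_zero a := by rw [gmul_def, map_zero]
  zero_mul b := by rw [gmul_def, map_zero, LinearMap.zero_apply]
  mul_add a b c := by rw [gmul_def, map_add]; rfl
  add_mul a b c := by rw [gmul_def, map_add]; rfl
  one_mul := by
    rintro ⟨n, a⟩
    obtain ⟨a, rfl⟩ := cls_surjective F n a
    exact mk_cls_eq F (zero_add n) (one_mul _)
  mul_one := by
    rintro ⟨n, a⟩
    obtain ⟨a, rfl⟩ := cls_surjective F n a
    exact mk_cls_eq F (add_zero n) (mul_one _)
  mul_assoc := by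
    rintro ⟨l, a⟩ ⟨m, b⟩ ⟨n, c⟩
    obtain ⟨a, rfl⟩ := cls_surjective F l a
    obtain ⟨b, rfl⟩ := cls_surjective F m b
    obtain ⟨c, rfl⟩ := cls_surjective F n c
    exact mk_cls_eq F (add_assoc l m n) (mul_assoc _ _ _)
  natCast k := k • GradedMonoid.GOne.one
  natCast_zero := zero_smul _ _
  natCast_succ k := succ_nsmul _ _
  intCast k := k • GradedMonoid.GOne.one
  intCast_ofNat k := natCast_zsmul _ _
  intCast_negSucc_ofNat k := negSucc_zsmul _ _

instance : DirectSum.GAlgebra ℂ (Piece F) where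
  toFun :=
    { toFun := fun r => r • cls F 0 ⟨1, SetLike.GradedOne.one_mem⟩
      map_zero' := zero_smul _ _
      map_add' := fun r s => add_smul _ _ _ }
  map_one := one_smul _ _
  map_mul r s := by
    simp only [AddMonoidHom.coe_mk, ZeroHom.coe_mk, ← map_smul]
    exact mk_cls_eq F (add_zero 0).symm (by simp [mul_smul, smul_comm r s])
  commutes := by
    rintro r ⟨n, a⟩
    obtain ⟨a, rfl⟩ := cls_surjective F n a
    simp only [AddMonoidHom.coe_mk, ZeroHom.coe_mk, ← map_smul]
    exact mk_cls_eq F ((zero_add n).trans (add_zero n).symm) (by simp)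
  smul_def := by
    rintro r ⟨n, a⟩
    obtain ⟨a, rfl⟩ := cls_surjective F n a
    simp only [AddMonoidHom.coe_mk, ZeroHom.coe_mk, ← map_smul]
    exact mk_cls_eq F (zero_add n).symm (by simp)

end

end AssocGraded

/-- The associated graded algebra `⨁ n, F_n / F_{<n}`. -/
abbrev AssocGr {A : Type*} [Ring A] [Algebra ℂ A] (F : ℕ → Submodule ℂ A) : Type _ :=
  ⨁ n, AssocGraded.Piece F n

namespace AssocGr

variable {A : Type*} [Ring A] [Algebra ℂ A] (F : ℕ → Submodule ℂ A)

/-- The principal symbol in degree `n`: the class of `a ∈ F_n` in `F_n / F_{<n} ⊆ gr A`. -/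
def symbol (n : ℕ) : F n →ₗ[ℂ] AssocGr F :=
  DirectSum.lof ℂ ℕ (AssocGraded.Piece F) n ∘ₗ AssocGraded.cls F n

theorem symbol_congr {m n : ℕ} (h : m = n) {a : F m} {b : F n}
    (hab : (a : A) - b ∈ AssocGraded.below F n) : symbol F m a = symbol F n b := by
  subst h
  exact congrArg (DirectSum.lof ℂ ℕ (AssocGraded.Piece F) m) ((AssocGraded.cls_eq_iff F).2 hab)

variable [SetLike.GradedMonoid F]

theorem symbol_mul (m n : ℕ) (a : F m) (b : F n) :
    symbol F m a * symbol F n b =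
      symbol F (m + n) ⟨a * b, SetLike.mul_mem_graded a.2 b.2⟩ :=
  DirectSum.of_mul_of _ _

theorem symbol_one : symbol F 0 ⟨1, SetLike.GradedOne.one_mem⟩ = 1 := rfl

end AssocGr

/-! ### Semidirect products `ℂ[G] ⋉ T(V)` and `ℂ[G] ⋉ S(V)` -/

/-- A lift of a linear map with pairwise commuting values to the symmetric algebra; the target
need not be commutative. -/
def SymmetricAlgebra.liftOfCommute {M B : Type*} [AddCommGroup M] [Module ℂ M] [Ring B]
    [Algebra ℂ B] (f : M →ₗ[ℂ] B) (hf : ∀ x y, f x * f y = f y * f x) :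
    SymmetricAlgebra ℂ M →ₐ[ℂ] B :=
  RingCon.liftₐ (TensorAlgebra.symRingCon ℂ M) (TensorAlgebra.lift ℂ f) (by
    refine RingCon.ringConGen_le.2 ?_
    rintro _ _ ⟨x, y⟩
    rw [RingCon.ker_apply]
    simpa using hf x y)

theorem SymmetricAlgebra.liftOfCommute_ι {M B : Type*} [AddCommGroup M] [Module ℂ M] [Ring B]
    [Algebra ℂ B] (f : M →ₗ[ℂ] B) (hf : ∀ x y, f x * f y = f y * f x) (x : M) :
    SymmetricAlgebra.liftOfCommute f hf (SymmetricAlgebra.ι ℂ M x) = f x :=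
  TensorAlgebra.lift_ι_apply f x

namespace SRA

variable {G V : Type*} [Group G] [AddCommGroup V] [Module ℂ V] (ρ : Representation ℂ G V)

/-- The tensor algebra `T(V)`, as an algebra with the action of `G` induced by `ρ`. -/
def TensorRep (_ρ : Representation ℂ G V) : Type _ := TensorAlgebra ℂ V

instance : Ring (TensorRep ρ) := inferInstanceAs (Ring (TensorAlgebra ℂ V))

instance : Algebra ℂ (TensorRep ρ) := inferInstanceAs (Algebra ℂ (TensorAlgebra ℂ V))

/-- The inclusion `V → T(V)`. -/
def TensorRep.ι : V →ₗ[ℂ] TensorRep ρ := TensorAlgebra.ι ℂ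

/-- The algebra endomorphism of `T(V)` that extends `g : V → V`. -/
def TensorRep.act (g : G) : TensorRep ρ →ₐ[ℂ] TensorRep ρ :=
  TensorAlgebra.lift ℂ (TensorRep.ι ρ ∘ₗ ρ g)

theorem TensorRep.act_ι (g : G) (x : V) :
    TensorRep.act ρ g (TensorRep.ι ρ x) = TensorRep.ι ρ (ρ g x) :=
  TensorAlgebra.lift_ι_apply _ x

theorem TensorRep.hom_ext {B : Type*} [Ring B] [Algebra ℂ B] {f f' : TensorRep ρ →ₐ[ℂ] B}
    (h : ∀ x, f (TensorRep.ι ρ x) = f' (TensorRep.ι ρ x)) : f = f' :=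
  TensorAlgebra.hom_ext (LinearMap.ext h)

instance : MulSemiringAction G (TensorRep ρ) where
  smul g a := TensorRep.act ρ g a
  one_smul a := DFunLike.congr_fun (f := TensorRep.act ρ 1) (g := AlgHom.id ℂ _)
    (TensorRep.hom_ext ρ fun x => by simp [TensorRep.act_ι]) a
  mul_smul g h a := DFunLike.congr_fun (f := TensorRep.act ρ (g * h))
    (g := (TensorRep.act ρ g).comp (TensorRep.act ρ h))
    (TensorRep.hom_ext ρ fun x => by simp [TensorRep.act_ι]) a
  smul_zero g := map_zero (TensorRep.act ρ g)
  smul_add g := map_add (TensorRep.act ρ g)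
  smul_one g := map_one (TensorRep.act ρ g)
  smul_mul g := map_mul (TensorRep.act ρ g)

theorem TensorRep.smul_def (g : G) (a : TensorRep ρ) : g • a = TensorRep.act ρ g a := rfl

theorem TensorRep.smul_ι (g : G) (x : V) : g • TensorRep.ι ρ x = TensorRep.ι ρ (ρ g x) :=
  TensorRep.act_ι ρ g x

instance : SMulCommClass G ℂ (TensorRep ρ) where
  smul_comm g c a := map_smul (TensorRep.act ρ g) c a

/-- The symmetric algebra `S(V)`, as an algebra with the action of `G` induced by `ρ`. -/
def SymRep (_ρ : Representation ℂ G V) : Type _ := SymmetricAlgebra ℂ V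

instance : CommRing (SymRep ρ) := inferInstanceAs (CommRing (SymmetricAlgebra ℂ V))

instance : Algebra ℂ (SymRep ρ) := inferInstanceAs (Algebra ℂ (SymmetricAlgebra ℂ V))

/-- The inclusion `V → S(V)`. -/
def SymRep.ι : V →ₗ[ℂ] SymRep ρ := SymmetricAlgebra.ι ℂ V

/-- The algebra endomorphism of `S(V)` that extends `g : V → V`. -/
def SymRep.act (g : G) : SymRep ρ →ₐ[ℂ] SymRep ρ :=
  SymmetricAlgebra.lift (SymRep.ι ρ ∘ₗ ρ g)

theorem SymRep.act_ι (g : G) (x : V) : SymRep.act ρ g (SymRep.ι ρ x) = SymRep.ι ρ (ρ g x) :=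
  SymmetricAlgebra.lift_ι_apply _ x

theorem SymRep.hom_ext {B : Type*} [Ring B] [Algebra ℂ B] {f f' : SymRep ρ →ₐ[ℂ] B}
    (h : ∀ x, f (SymRep.ι ρ x) = f' (SymRep.ι ρ x)) : f = f' := by
  refine AlgHom.ext fun a => ?_
  refine SymmetricAlgebra.induction ℂ V (motive := fun a => f a = f' a) ?_ h ?_ ?_ a
  · intro r
    exact (f.commutes r).trans (f'.commutes r).symm
  · intro a b ha hb
    exact (map_mul f a b).trans ((congrArg₂ (· * ·) ha hb).trans (map_mul f' a b).symm)
  · intro a b ha hb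
    exact (map_add f a b).trans ((congrArg₂ (· + ·) ha hb).trans (map_add f' a b).symm)

instance : MulSemiringAction G (SymRep ρ) where
  smul g a := SymRep.act ρ g a
  one_smul a := DFunLike.congr_fun (f := SymRep.act ρ 1) (g := AlgHom.id ℂ _)
    (SymRep.hom_ext ρ fun x => by simp [SymRep.act_ι]) a
  mul_smul g h a := DFunLike.congr_fun (f := SymRep.act ρ (g * h))
    (g := (SymRep.act ρ g).comp (SymRep.act ρ h))
    (SymRep.hom_ext ρ fun x => by simp [SymRep.act_ι]) a
  smul_zero g := map_zero (SymRep.act ρ g)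
  smul_add g := map_add (SymRep.act ρ g)
  smul_one g := map_one (SymRep.act ρ g)
  smul_mul g := map_mul (SymRep.act ρ g)

theorem SymRep.smul_def (g : G) (a : SymRep ρ) : g • a = SymRep.act ρ g a := rfl

theorem SymRep.smul_ι (g : G) (x : V) : g • SymRep.ι ρ x = SymRep.ι ρ (ρ g x) :=
  SymRep.act_ι ρ g x

instance : SMulCommClass G ℂ (SymRep ρ) where
  smul_comm g c a := map_smul (SymRep.act ρ g) c a

/-- The semidirect product `ℂ[G] ⋉ T(V)`: it has the underlying space `T(V) ⊗ ℂ[G]`, and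
`(a g) (b h) = (a (g • b)) (g h)` for `a, b ∈ T(V)` and `g, h ∈ G`. -/
abbrev TensorCross : Type _ := SkewMonoidAlgebra (TensorRep ρ) G

/-- The semidirect product `ℂ[G] ⋉ S(V)`, with the same conventions. -/
abbrev SymCross : Type _ := SkewMonoidAlgebra (SymRep ρ) G

/-! ### The algebra `H_κ` -/

/-- The inclusion `V → ℂ[G] ⋉ T(V)`. -/
def TensorCross.vec : V →ₗ[ℂ] TensorCross ρ :=
  SkewMonoidAlgebra.lsingle ℂ 1 ∘ₗ TensorRep.ι ρ

/-- The inclusion `ℂ[G] → ℂ[G] ⋉ T(V)`. -/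
def TensorCross.grp : MonoidAlgebra ℂ G →ₐ[ℂ] TensorCross ρ :=
  MonoidAlgebra.lift ℂ (TensorCross ρ) G (SkewMonoidAlgebra.of (TensorRep ρ) G)

/-- `x ∧ y ∈ ∧²V`. -/
def wedge (x y : V) : ⋀[ℂ]^2 V := exteriorPower.ιMulti ℂ 2 ![x, y]

variable (κ : ⋀[ℂ]^2 V →ₗ[ℂ] MonoidAlgebra ℂ G)

/-- The defining relations `[x, y] = κ(x, y)`, for `x, y ∈ V`, of `H_κ`. -/
inductive Rel : TensorCross ρ → TensorCross ρ → Prop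
  | comm (x y : V) : Rel
      (TensorCross.vec ρ x * TensorCross.vec ρ y - TensorCross.vec ρ y * TensorCross.vec ρ x)
      (TensorCross.grp ρ (κ (wedge x y)))

/-- The algebra `H_κ`, the quotient of `ℂ[G] ⋉ T(V)` by the two-sided ideal generated by the
elements `[x, y] - κ(x, y)`, for `x, y ∈ V`. -/
abbrev H : Type _ := RingQuot (Rel ρ κ)

/-- The map `V → H_κ`. -/
def H.vec : V →ₗ[ℂ] H ρ κ := (RingQuot.mkAlgHom ℂ (Rel ρ κ)).toLinearMap ∘ₗ TensorCross.vec ρ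

/-- The map `ℂ[G] → H_κ`. -/
def H.grp : MonoidAlgebra ℂ G →ₐ[ℂ] H ρ κ :=
  (RingQuot.mkAlgHom ℂ (Rel ρ κ)).comp (TensorCross.grp ρ)

theorem H.comm (x y : V) :
    H.vec ρ κ x * H.vec ρ κ y - H.vec ρ κ y * H.vec ρ κ x = H.grp ρ κ (κ (wedge x y)) := by
  have h := RingQuot.mkAlgHom_rel ℂ (Rel.comm (ρ := ρ) (κ := κ) x y)
  rwa [map_sub, map_mul, map_mul] at h

theorem H.grp_mul_vec (g : G) (x : V) :
    H.grp ρ κ (MonoidAlgebra.single g 1) * H.vec ρ κ x =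
      H.vec ρ κ (ρ g x) * H.grp ρ κ (MonoidAlgebra.single g 1) := by
  have h : TensorCross.grp ρ (MonoidAlgebra.single g 1) * TensorCross.vec ρ x =
      TensorCross.vec ρ (ρ g x) * TensorCross.grp ρ (MonoidAlgebra.single g 1) := by
    rw [TensorCross.grp, MonoidAlgebra.lift_single, one_smul, SkewMonoidAlgebra.of_apply]
    change SkewMonoidAlgebra.single g 1 * SkewMonoidAlgebra.single 1 (TensorRep.ι ρ x) =
      SkewMonoidAlgebra.single 1 (TensorRep.ι ρ (ρ g x)) * SkewMonoidAlgebra.single g 1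
    rw [SkewMonoidAlgebra.single_mul_single, SkewMonoidAlgebra.single_mul_single,
      TensorRep.smul_ι, smul_one, one_mul, mul_one, mul_one, one_mul]
  have h' := congrArg (RingQuot.mkAlgHom ℂ (Rel ρ κ)) h
  rwa [map_mul, map_mul] at h'

/-- The increasing filtration on `H_κ` with `deg V = 1` and `deg G = 0`: `F_n` is the span of the
products `x₁ ⋯ x_k g` with `k ≤ n`, `x_i ∈ V` and `g ∈ G`. -/
def H.filtration (n : ℕ) : Submodule ℂ (H ρ κ) :=
  (1 ⊔ LinearMap.range (H.vec ρ κ)) ^ n * LinearMap.range (H.grp ρ κ).toLinearMap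

theorem pow_mul_mul_pow_mul_le {A : Type*} [Ring A] [Algebra ℂ A] {P B : Submodule ℂ A}
    (hP : B * P ≤ P * B) (hB : B * B ≤ B) (m n : ℕ) :
    (P ^ m * B) * (P ^ n * B) ≤ P ^ (m + n) * B := by
  have h : B * P ^ n ≤ P ^ n * B := by
    induction n with
    | zero => rw [pow_zero, mul_one, one_mul]
    | succ n ih =>
      rw [pow_succ, ← mul_assoc]
      refine (mul_le_mul' ih le_rfl).trans ?_
      rw [mul_assoc, mul_assoc]
      exact mul_le_mul' le_rfl hP
  calc (P ^ m * B) * (P ^ n * B) = P ^ m * ((B * P ^ n) * B) := by simp only [mul_assoc]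
    _ ≤ P ^ m * ((P ^ n * B) * B) := mul_le_mul' le_rfl (mul_le_mul' h le_rfl)
    _ = P ^ (m + n) * (B * B) := by simp only [mul_assoc, pow_add]
    _ ≤ P ^ (m + n) * B := mul_le_mul' le_rfl hB

theorem H.vec_mem (x : V) : H.vec ρ κ x ∈ H.filtration ρ κ 1 := by
  rw [H.filtration, pow_one, ← mul_one (H.vec ρ κ x)]
  exact Submodule.mul_mem_mul (Submodule.mem_sup_right ⟨x, rfl⟩) ⟨1, map_one (H.grp ρ κ)⟩

theorem H.grp_mem (a : MonoidAlgebra ℂ G) : H.grp ρ κ a ∈ H.filtration ρ κ 0 := by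
  rw [H.filtration, pow_zero, one_mul]
  exact ⟨a, rfl⟩

theorem H.range_grp_mul_le :
    LinearMap.range (H.grp ρ κ).toLinearMap * (1 ⊔ LinearMap.range (H.vec ρ κ)) ≤
      (1 ⊔ LinearMap.range (H.vec ρ κ)) * LinearMap.range (H.grp ρ κ).toLinearMap := by
  rw [Submodule.mul_sup, Submodule.sup_mul, mul_one, one_mul]
  refine sup_le_sup le_rfl (Submodule.mul_le.2 ?_)
  rintro _ ⟨a, rfl⟩ _ ⟨x, rfl⟩
  induction a using MonoidAlgebra.induction_linear with
  | zero => simp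
  | add a b ha hb =>
    rw [map_add, add_mul]
    exact Submodule.add_mem _ ha hb
  | single g r =>
    have h : (MonoidAlgebra.single g r : MonoidAlgebra ℂ G) = r • MonoidAlgebra.single g 1 := by
      simp
    rw [h, map_smul, smul_mul_assoc]
    refine Submodule.smul_mem _ _ ?_
    have h' := H.grp_mul_vec ρ κ g x
    rw [AlgHom.toLinearMap_apply, h']
    exact Submodule.mul_mem_mul ⟨_, rfl⟩ ⟨_, rfl⟩

instance : SetLike.GradedMonoid (H.filtration ρ κ) where
  one_mem := by
    rw [← map_one (H.grp ρ κ)]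
    exact H.grp_mem ρ κ 1
  mul_mem m n a b ha hb := by
    have hB : LinearMap.range (H.grp ρ κ).toLinearMap * LinearMap.range (H.grp ρ κ).toLinearMap ≤
        LinearMap.range (H.grp ρ κ).toLinearMap := by
      refine Submodule.mul_le.2 ?_
      rintro _ ⟨a, rfl⟩ _ ⟨b, rfl⟩
      exact ⟨a * b, map_mul (H.grp ρ κ) a b⟩
    exact pow_mul_mul_pow_mul_le (H.range_grp_mul_le ρ κ) hB m n (Submodule.mul_mem_mul ha hb)

/-- The associated graded algebra `gr H_κ`. -/
abbrev GrH : Type _ := AssocGr (H.filtration ρ κ)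

/-- The map `V → gr H_κ` that sends `x` to its symbol in degree `1`. -/
def GrH.vec : V →ₗ[ℂ] GrH ρ κ :=
  AssocGr.symbol (H.filtration ρ κ) 1 ∘ₗ (H.vec ρ κ).codRestrict _ (H.vec_mem ρ κ)

/-- The map `G → gr H_κ` that sends `g` to its symbol in degree `0`. -/
def GrH.grp : G →* GrH ρ κ where
  toFun g := AssocGr.symbol (H.filtration ρ κ) 0
    ⟨H.grp ρ κ (MonoidAlgebra.single g 1), H.grp_mem ρ κ _⟩
  map_one' := (AssocGr.symbol_congr _ rfl (by
    simp [← MonoidAlgebra.one_def])).trans (AssocGr.symbol_one _)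
  map_mul' g h := by
    rw [AssocGr.symbol_mul]
    refine AssocGr.symbol_congr _ rfl ?_
    change H.grp ρ κ (MonoidAlgebra.single (g * h) 1) -
      H.grp ρ κ (MonoidAlgebra.single g 1) * H.grp ρ κ (MonoidAlgebra.single h 1) ∈ _
    rw [← map_mul, MonoidAlgebra.single_mul_single, one_mul, sub_self]
    exact Submodule.zero_mem _

theorem GrH.vec_mul_comm (x y : V) :
    GrH.vec ρ κ x * GrH.vec ρ κ y = GrH.vec ρ κ y * GrH.vec ρ κ x := by
  refine (AssocGr.symbol_mul _ 1 1 _ _).trans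
    (Eq.trans (AssocGr.symbol_congr _ rfl ?_) (AssocGr.symbol_mul _ 1 1 _ _).symm)
  change H.vec ρ κ x * H.vec ρ κ y - H.vec ρ κ y * H.vec ρ κ x ∈ _
  rw [H.comm]
  exact AssocGraded.mem_below _ (by norm_num : 0 < 1 + 1) (H.grp_mem ρ κ _)

theorem GrH.grp_mul_vec (g : G) (x : V) :
    GrH.grp ρ κ g * GrH.vec ρ κ x = GrH.vec ρ κ (ρ g x) * GrH.grp ρ κ g := by
  refine (AssocGr.symbol_mul _ 0 1 _ _).trans
    (Eq.trans (AssocGr.symbol_congr _ rfl ?_) (AssocGr.symbol_mul _ 1 0 _ _).symm)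
  change H.grp ρ κ (MonoidAlgebra.single g 1) * H.vec ρ κ x -
    H.vec ρ κ (ρ g x) * H.grp ρ κ (MonoidAlgebra.single g 1) ∈ _
  rw [H.grp_mul_vec, sub_self]
  exact Submodule.zero_mem _

/-- The algebra homomorphism `S(V) → gr H_κ` that extends `V → gr H_κ`. -/
def GrH.sym : SymRep ρ →ₐ[ℂ] GrH ρ κ :=
  SymmetricAlgebra.liftOfCommute (GrH.vec ρ κ) (GrH.vec_mul_comm ρ κ)

theorem GrH.sym_ι (x : V) : GrH.sym ρ κ (SymRep.ι ρ x) = GrH.vec ρ κ x :=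
  SymmetricAlgebra.liftOfCommute_ι _ _ x

theorem GrH.sym_smul_mul (g : G) (a : SymRep ρ) :
    GrH.sym ρ κ (g • a) * GrH.grp ρ κ g = GrH.grp ρ κ g * GrH.sym ρ κ a := by
  refine SymmetricAlgebra.induction ℂ V (motive := fun a : SymRep ρ =>
    GrH.sym ρ κ (g • a) * GrH.grp ρ κ g = GrH.grp ρ κ g * GrH.sym ρ κ a) ?_ ?_ ?_ ?_ a
  · intro r
    change GrH.sym ρ κ (SymRep.act ρ g (algebraMap ℂ (SymRep ρ) r)) * _ =
      _ * GrH.sym ρ κ (algebraMap ℂ (SymRep ρ) r)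
    rw [AlgHom.commutes, AlgHom.commutes, Algebra.commutes]
  · intro x
    change GrH.sym ρ κ (g • SymRep.ι ρ x) * _ = _ * GrH.sym ρ κ (SymRep.ι ρ x)
    rw [SymRep.smul_ι, GrH.sym_ι, GrH.sym_ι, GrH.grp_mul_vec]
  · intro (a : SymRep ρ) (b : SymRep ρ) ha hb
    change GrH.sym ρ κ (g • (a * b)) * _ =
      _ * GrH.sym ρ κ (a * b)
    rw [smul_mul', map_mul, map_mul, mul_assoc, hb, ← mul_assoc, ha, mul_assoc]
  · intro (a : SymRep ρ) (b : SymRep ρ) ha hb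
    change GrH.sym ρ κ (g • (a + b)) * _ =
      _ * GrH.sym ρ κ (a + b)
    rw [smul_add, map_add, map_add, add_mul, mul_add, ha, hb]

/-- The natural homomorphism `ξ : ℂ[G] ⋉ S(V) → gr H_κ`. -/
def xi : SymCross ρ →ₐ[ℂ] GrH ρ κ :=
  SkewMonoidAlgebra.liftNCAlgHom (GrH.sym ρ κ) (GrH.grp ρ κ) (GrH.sym_smul_mul ρ κ _ _)

theorem xi_vec (x : V) :
    xi ρ κ (SkewMonoidAlgebra.single 1 (SymRep.ι ρ x)) =
      AssocGr.symbol (H.filtration ρ κ) 1 ⟨H.vec ρ κ x, H.vec_mem ρ κ x⟩ := by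
  refine (SkewMonoidAlgebra.liftNC_single _ _ _ _).trans ?_
  rw [map_one, mul_one]
  exact GrH.sym_ι ρ κ x

theorem xi_grp (g : G) :
    xi ρ κ (SkewMonoidAlgebra.single g 1) =
      AssocGr.symbol (H.filtration ρ κ) 0
        ⟨H.grp ρ κ (MonoidAlgebra.single g 1), H.grp_mem ρ κ _⟩ := by
  refine (SkewMonoidAlgebra.liftNC_single _ _ _ _).trans ?_
  refine Eq.trans ?_ (one_mul _)
  exact congrArg (· * _) (map_one (GrH.sym ρ κ))

/-! ### Symplectic reflections -/

/-- The set `S` of symplectic reflections: the `s ∈ G` such that `s - 1` has rank `2` on `V`. -/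
def symplecticReflections : Set G :=
  {s | Module.finrank ℂ (LinearMap.range (ρ s - 1)) = 2}

theorem isCompl_range_ker [Finite G] [FiniteDimensional ℂ V] (s : G) :
    IsCompl (LinearMap.range (1 - ρ s)) (LinearMap.ker (1 - ρ s)) := by
  have hd : Disjoint (LinearMap.range (1 - ρ s)) (LinearMap.ker (1 - ρ s)) := by
    rw [Submodule.disjoint_def]
    rintro _ ⟨v, rfl⟩ hx
    set x := (1 - ρ s) v with hxv
    have hfix : ρ s x = x := by
      have h : x - ρ s x = 0 := hx
      exact (sub_eq_zero.1 h).symm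
    have hadd : ∀ n : ℕ, ((n : ℂ)) • x = v - (ρ s ^ n) v := by
      intro n
      induction n with
      | zero => simp
      | succ n ih =>
        have hn : (ρ s ^ n) x = x := by
          clear ih
          induction n with
          | zero => simp
          | succ n ih => rw [pow_succ, Module.End.mul_apply, hfix, ih]
        have h2 : (ρ s ^ n) x = (ρ s ^ n) v - (ρ s ^ (n + 1)) v := by
          rw [hxv, pow_succ, Module.End.mul_apply, ← map_sub]
          rfl
        rw [hn] at h2
        rw [Nat.cast_succ, add_smul, one_smul, ih]
        exact (congrArg (v - (ρ s ^ n) v + ·) h2).trans (sub_add_sub_cancel _ _ _)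
    have h0 := hadd (orderOf s)
    rw [← map_pow, pow_orderOf_eq_one, map_one, Module.End.one_apply, sub_self] at h0
    exact (smul_eq_zero.1 h0).resolve_left (Nat.cast_ne_zero.2 (orderOf_pos s).ne')
  refine ⟨hd, codisjoint_iff.2 (Submodule.eq_top_of_disjoint _ _ ?_ hd)⟩
  exact (LinearMap.finrank_range_add_finrank_ker _).ge

/-- `ω_s(x, y)`: the form `ω` applied to the projections of `x` and `y` to the image of `1 - s`
along the kernel of `1 - s`. -/
def reflForm [Finite G] [FiniteDimensional ℂ V] (ω : LinearMap.BilinForm ℂ V) (s : G) (x y : V) :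
    ℂ :=
  ω ((LinearMap.range (1 - ρ s)).projection (LinearMap.ker (1 - ρ s)) (isCompl_range_ker ρ s) x)
    ((LinearMap.range (1 - ρ s)).projection (LinearMap.ker (1 - ρ s)) (isCompl_range_ker ρ s) y)

end SRA

end

noncomputable section

/-! ### The normal form module -/

namespace PBW

/-! Both directions of the equivalence pass through the Jacobi identity for κ. Write κ = Σ κ_g g.
Since [g, x] = (gx - x) g, the identity [κ(y,z), x] + [κ(z,x), y] + [κ(x,y), z] = 0 splits over g
into κ_g(y,z)(gx - x) + κ_g(z,x)(gy - y) + κ_g(x,y)(gz - z) = 0; this is `PBW.Jacobi`.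

If ξ is injective, Jacobi holds: commutators in H_κ satisfy their own Jacobi identity, so Σ w_g g =
0 in H_κ, where w_g is the left side above. The symbol of this sum in degree 1 is the image under ξ
of the same sum in ℂ[G] ⋉ SV, so every w_g vanishes (`jacobi_of_xi_injective`).

If Jacobi holds, ξ is injective by a diamond lemma argument. Rather than comparing rewritings, one
lets H_κ act on the space with basis the normal words b_{i₁} ⋯ b_{i_k} g, i₁ ≤ ⋯ ≤ i_k. The action
is defined by recursion on degree, and the relations are checked by induction on degree
(`PBW.relAt`): the overlap b_i b_j b_k needs Jacobi, and the overlap g b_i b_k needs equivariance.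
Acting on the empty word yields a normal form, whose top degree part recovers a normal word from its
image under ξ; the normal words span ℂ[G] ⋉ SV (`xi_injective_of_relAt`).

It remains to solve the Jacobi identity for each g. The image and kernel of 1 - g are ω-orthogonal
complements, so rank 1 cannot occur. Rank at least 3 forces κ_g = 0. In rank 2, κ_g kills the kernel
and lives on a plane, so it is a multiple of ω_g. For g = 1, invariance gives a multiple of ω
(`form_of_jacobi`; conversely `jacobi_of_form`). Surjectivity of ξ is formal: the symbols of V and G
generate gr H_κ (`xi_surjective`). -/

theorem exists_min_mem {ι : Type*} [LinearOrder ι] {m : Multiset ι} (h : m ≠ 0) :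
    ∃ j ∈ m, ∀ k ∈ m, j ≤ k := by
  obtain ⟨j, hj, hmin⟩ := m.toFinset.exists_min_image id
    (Multiset.toFinset_nonempty.2 h)
  exact ⟨j, Multiset.mem_toFinset.1 hj, fun k hk => hmin k (Multiset.mem_toFinset.2 hk)⟩

/-- A multiset in a linear order is empty or arises by inserting a least element. -/
theorem exists_cons_min {ι : Type*} [LinearOrder ι] (m : Multiset ι) :
    m = 0 ∨ ∃ j m', (∀ k ∈ m', j ≤ k) ∧ m = j ::ₘ m' := by
  rcases eq_or_ne m 0 with h | h
  · exact Or.inl h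
  · obtain ⟨j, hj, hmin⟩ := exists_min_mem h
    exact Or.inr ⟨j, m.erase j, fun k hk => hmin k (Multiset.mem_of_mem_erase hk),
      (Multiset.cons_erase hj).symm⟩

/-- The least element of a nonempty multiset. -/
def minElt {ι : Type*} [LinearOrder ι] (m : Multiset ι) (h : m ≠ 0) : ι :=
  (exists_min_mem h).choose

theorem minElt_cons {ι : Type*} [LinearOrder ι] {m : Multiset ι} {j : ι} (hj : ∀ k ∈ m, j ≤ k) :
    minElt (j ::ₘ m) (Multiset.cons_ne_zero) = j := by
  obtain ⟨h₁, h₂⟩ := (exists_min_mem (Multiset.cons_ne_zero (a := j) (m := m))).choose_spec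
  refine le_antisymm (h₂ j (Multiset.mem_cons_self _ _)) ?_
  rcases Multiset.mem_cons.1 h₁ with h | h
  · exact h.ge
  · exact hj _ h

variable {G V ι : Type*} [AddCommGroup V] [Module ℂ V]

/-- The space with basis the normal words `b_{i₁} ⋯ b_{i_k} g`, `i₁ ≤ ⋯ ≤ i_k`. -/
abbrev Mod (ι G : Type*) : Type _ := (Multiset ι × G) →₀ ℂ

/-- The basis vector of a normal word. -/
abbrev E (m : Multiset ι) (g : G) : Mod ι G := Finsupp.single (m, g) 1

/-- The span of the normal words of degree at most `n`. -/
def fil (ι G : Type*) (n : ℕ) : Submodule ℂ (Mod ι G) :=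
  Finsupp.supported ℂ ℂ {p | p.1.card ≤ n}

theorem E_mem_fil {n : ℕ} {m : Multiset ι} {g : G} (h : m.card ≤ n) : E m g ∈ fil ι G n :=
  Finsupp.single_mem_supported ℂ 1 h

theorem fil_mono {m n : ℕ} (h : m ≤ n) : fil ι G m ≤ fil ι G n :=
  Finsupp.supported_mono fun _ hp => le_trans hp h

theorem fil_le {n : ℕ} {N : Submodule ℂ (Mod ι G)} (h : ∀ m g, m.card ≤ n → E m g ∈ N) :
    fil ι G n ≤ N := by
  rw [fil, Finsupp.supported_eq_span_single, Submodule.span_le]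
  rintro _ ⟨⟨m, g⟩, hp, rfl⟩
  exact h m g hp

theorem eq_on_fil {W : Type*} [AddCommGroup W] [Module ℂ W] {n : ℕ} {φ ψ : Mod ι G →ₗ[ℂ] W}
    (h : ∀ m g, m.card ≤ n → φ (E m g) = ψ (E m g)) {f : Mod ι G} (hf : f ∈ fil ι G n) :
    φ f = ψ f :=
  fil_le (N := LinearMap.eqLocus φ ψ) h hf

/-- Values of the operators `b_i` and `g` on the normal words. -/
abbrev Action (ι G : Type*) : Type _ := Multiset ι × G → (ι → Mod ι G) × (G → Mod ι G)

/-- The operator of `b_i`. -/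
def opX (A : Action ι G) (i : ι) : Module.End ℂ (Mod ι G) :=
  Finsupp.linearCombination ℂ fun r => (A r).1 i

/-- The operator of `g`. -/
def opG (A : Action ι G) (g : G) : Module.End ℂ (Mod ι G) :=
  Finsupp.linearCombination ℂ fun r => (A r).2 g

@[simp] theorem opX_E (A : Action ι G) (i : ι) (m : Multiset ι) (g : G) :
    opX A i (E m g) = (A (m, g)).1 i := by
  simp [opX, E]

@[simp] theorem opG_E (A : Action ι G) (h : G) (m : Multiset ι) (g : G) :
    opG A h (E m g) = (A (m, g)).2 h := by
  simp [opG, E]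

/-- The operator of a vector. -/
def vecOp (b : Module.Basis ι ℂ V) (A : Action ι G) : V →ₗ[ℂ] Module.End ℂ (Mod ι G) :=
  b.constr ℂ (opX A)

@[simp] theorem vecOp_basis (b : Module.Basis ι ℂ V) (A : Action ι G) (i : ι) :
    vecOp b A (b i) = opX A i :=
  b.constr_basis ℂ _ i

/-- The operator of an element of the group algebra. -/
def algOp (A : Action ι G) : MonoidAlgebra ℂ G →ₗ[ℂ] Module.End ℂ (Mod ι G) :=
  Finsupp.linearCombination ℂ (opG A) ∘ₗ (MonoidAlgebra.coeffLinearEquiv ℂ).toLinearMap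

@[simp] theorem algOp_single (A : Action ι G) (g : G) (c : ℂ) :
    algOp A (MonoidAlgebra.single g c) = c • opG A g := by
  simp [algOp]

theorem apply_mem_of_basis (b : Module.Basis ι ℂ V) (φ : V →ₗ[ℂ] Module.End ℂ (Mod ι G))
    {N : Submodule ℂ (Mod ι G)} {f : Mod ι G} (h : ∀ i, φ (b i) f ∈ N) (v : V) : φ v f ∈ N := by
  have : (⊤ : Submodule ℂ V) ≤ N.comap ((LinearMap.applyₗ f).comp φ) := by
    rw [← b.span_eq, Submodule.span_le]
    rintro _ ⟨i, rfl⟩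
    exact h i
  exact this trivial

/-- The recursion for `act` cuts its own values off at words of smaller degree. This and the next
three lemmas show that the cut is invisible on vectors of low enough degree. -/
theorem opX_trunc (A : Action ι G) (n : ℕ) (i : ι) {f : Mod ι G} (hf : f ∈ fil ι G n) :
    opX (fun r => if r.1.card < n + 1 then A r else 0) i f = opX A i f :=
  eq_on_fil (fun m g hm => by simp only [opX_E, Nat.lt_succ_of_le hm, if_true]) hf

theorem opG_trunc (A : Action ι G) (n : ℕ) (i : G) {f : Mod ι G} (hf : f ∈ fil ι G n) :
    opG (fun r => if r.1.card < n + 1 then A r else 0) i f = opG A i f :=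
  eq_on_fil (fun m g hm => by simp only [opG_E, Nat.lt_succ_of_le hm, if_true]) hf

theorem vecOp_trunc (b : Module.Basis ι ℂ V) (A : Action ι G) (n : ℕ) (v : V) {f : Mod ι G} (hf : f ∈ fil ι G n) :
    vecOp b (fun r => if r.1.card < n + 1 then A r else 0) v f = vecOp b A v f := by
  have : (LinearMap.applyₗ f).comp (vecOp b (fun r => if r.1.card < n + 1 then A r else 0)) =
      (LinearMap.applyₗ f).comp (vecOp b A) :=
    b.ext fun i => by
      rw [LinearMap.comp_apply, LinearMap.comp_apply, vecOp_basis, vecOp_basis]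
      exact opX_trunc A n i hf
  exact LinearMap.congr_fun this v

theorem algOp_trunc (A : Action ι G) (n : ℕ) (a : MonoidAlgebra ℂ G) {f : Mod ι G}
    (hf : f ∈ fil ι G n) :
    algOp (fun r => if r.1.card < n + 1 then A r else 0) a f = algOp A a f := by
  induction a using MonoidAlgebra.induction_linear with
  | zero => simp
  | add a a' h h' => rw [map_add, map_add, LinearMap.add_apply, LinearMap.add_apply, h, h']
  | single g c =>
    rw [algOp_single, algOp_single, LinearMap.smul_apply, LinearMap.smul_apply,
      opG_trunc A n g hf]

/-! ### Recursive definition of the action and its degree bounds -/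

variable [Group G] [LinearOrder ι] (b : Module.Basis ι ℂ V) (ρ : Representation ℂ G V)
  (B : V →ₗ[ℂ] V →ₗ[ℂ] MonoidAlgebra ℂ G)

/-- One step of the recursive definition of the action on normal words. -/
def step (A : Action ι G) : Action ι G := fun p =>
  if h : p.1 = 0 then (fun i => E {i} p.2, fun g => E 0 (g * p.2))
  else
    let j := minElt p.1 h
    let m := p.1.erase j
    (fun i => if i ≤ j then E (i ::ₘ p.1) p.2 else
      -- This is b_i b_j m = b_j b_i m + κ(b_i, b_j) m. The leading word of b_j b_i m is split off
      -- by hand, so that the operator of b_j is applied only to a vector of degree at most that of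
      -- m, which keeps the recursion well founded.
      E (i ::ₘ p.1) p.2 + opX A j (opX A i (E m p.2) - E (i ::ₘ m) p.2) +
        algOp A (B (b i) (b j)) (E m p.2),
    fun g => vecOp b A (ρ g (b j)) (opG A g (E m p.2)))

/-- The action of the generators on the normal words. -/
def act : Action ι G := fun p =>
  -- The default value 0 on words that are not shorter only serves termination; `deg_act` implies
  -- that it is never read.
  step b ρ B (fun r => if r.1.card < p.1.card then act r else 0) p
termination_by p => p.1.card

/-- The action of `b_i` on `M`. -/
def X (i : ι) : Module.End ℂ (Mod ι G) := opX (act b ρ B) i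

/-- The action of `g` on `M`. -/
def Γ (g : G) : Module.End ℂ (Mod ι G) := opG (act b ρ B) g

/-- The action of `V` on `M`. -/
def XV : V →ₗ[ℂ] Module.End ℂ (Mod ι G) := vecOp b (act b ρ B)

/-- The action of `ℂ[G]` on `M`. -/
def K : MonoidAlgebra ℂ G →ₗ[ℂ] Module.End ℂ (Mod ι G) := algOp (act b ρ B)

@[simp] theorem XV_basis (i : ι) : XV b ρ B (b i) = X b ρ B i := vecOp_basis _ _ _

@[simp] theorem K_single (g : G) (c : ℂ) :
    K b ρ B (MonoidAlgebra.single g c) = c • Γ b ρ B g := algOp_single _ _ _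

theorem X_zero (i : ι) (g : G) : X b ρ B i (E 0 g) = E {i} g := by
  rw [X, opX_E, act]
  simp [step]

theorem Γ_zero (g h : G) : Γ b ρ B g (E 0 h) = E 0 (g * h) := by
  rw [Γ, opG_E, act]
  simp [step]

theorem X_cons_of_le {i j : ι} {m : Multiset ι} (hj : ∀ k ∈ m, j ≤ k) (hij : i ≤ j) (g : G) :
    X b ρ B i (E (j ::ₘ m) g) = E (i ::ₘ j ::ₘ m) g := by
  rw [X, opX_E, act]
  simp [step, minElt_cons hj, hij]

theorem X_of_le {i : ι} {m : Multiset ι} (hi : ∀ k ∈ m, i ≤ k) (g : G) :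
    X b ρ B i (E m g) = E (i ::ₘ m) g := by
  rcases exists_cons_min m with rfl | ⟨j, m, hj, rfl⟩
  · exact X_zero b ρ B i g
  · exact X_cons_of_le b ρ B hj (hi j (Multiset.mem_cons_self _ _)) g

/-- The difference between b_i m and the word with b_i inserted has degree at most that of m, so one
further letter b_j brings it only to the degree of b_j m, while κ adds no letters. The hypothesis
concerns shorter words alone, as `step` consults no others. -/
theorem deg_step {A : Action ι G} (p : Multiset ι × G)
    (hA : ∀ r : Multiset ι × G, r.1.card < p.1.card →
      (∀ i, opX A i (E r.1 r.2) - E (i ::ₘ r.1) r.2 ∈ fil ι G r.1.card) ∧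
      ∀ g, opG A g (E r.1 r.2) ∈ fil ι G r.1.card) :
    (∀ i, (step b ρ B A p).1 i - E (i ::ₘ p.1) p.2 ∈ fil ι G p.1.card) ∧
      ∀ g, (step b ρ B A p).2 g ∈ fil ι G p.1.card := by
  obtain ⟨m, h⟩ := p
  rcases exists_cons_min m with rfl | ⟨j, m, hj, rfl⟩
  · exact ⟨fun i => by simp [step], fun g => by simpa [step] using! E_mem_fil (Nat.zero_le 0)⟩
  have hlt : m.card < (j ::ₘ m).card := by simp
  have hG : ∀ g, ∀ f ∈ fil ι G m.card, opG A g f ∈ fil ι G m.card := fun g f hf =>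
    fil_le (N := (fil ι G m.card).comap (opG A g)) (fun m' g' hm' =>
      fil_mono hm' ((hA (m', g') (hm'.trans_lt hlt)).2 g)) hf
  have hX : ∀ i, ∀ f ∈ fil ι G m.card, opX A i f ∈ fil ι G (j ::ₘ m).card := fun i f hf =>
    fil_le (N := (fil ι G (j ::ₘ m).card).comap (opX A i)) (fun m' g' hm' => by
      have h₁ := (hA (m', g') (hm'.trans_lt hlt)).1 i
      have h₂ : E (i ::ₘ m') g' ∈ fil ι G (j ::ₘ m).card := E_mem_fil (by simpa using hm')
      have := add_mem (fil_mono (hm'.trans hlt.le) h₁) h₂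
      simpa using this) hf
  have hV : ∀ v, ∀ f ∈ fil ι G m.card, vecOp b A v f ∈ fil ι G (j ::ₘ m).card := by
    intro v f hf
    refine apply_mem_of_basis b _ (fun i => ?_) v
    rw [vecOp_basis]
    exact hX i f hf
  have hK : ∀ a, ∀ f ∈ fil ι G m.card, algOp A a f ∈ fil ι G m.card := by
    intro a f hf
    induction a using MonoidAlgebra.induction_linear with
    | zero => simp
    | add a a' h h' => rw [map_add]; exact add_mem h h'
    | single g c => rw [algOp_single]; exact Submodule.smul_mem _ _ (hG g f hf)
  have hE : E m h ∈ fil ι G m.card := E_mem_fil le_rfl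
  constructor
  · intro i
    simp only [step, Multiset.cons_ne_zero, dite_false, minElt_cons hj, Multiset.erase_cons_head]
    split_ifs
    · simp
    · rw [add_assoc, add_sub_cancel_left]
      exact add_mem (hX j _ ((hA (m, h) hlt).1 i)) (fil_mono hlt.le (hK _ _ hE))
  · intro g
    simp only [step, Multiset.cons_ne_zero, dite_false, minElt_cons hj, Multiset.erase_cons_head]
    exact hV _ _ (hG g _ hE)

theorem deg_act (m : Multiset ι) (h : G) :
    (∀ i, X b ρ B i (E m h) - E (i ::ₘ m) h ∈ fil ι G m.card) ∧
      ∀ g, Γ b ρ B g (E m h) ∈ fil ι G m.card := by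
  induction hn : m.card using Nat.strong_induction_on generalizing m h with
  | _ n ih =>
    subst hn
    simp only [X, Γ, opX_E, opG_E] at ih ⊢
    rw [act]
    refine deg_step b ρ B (m, h) fun r hr => ?_
    simpa [hr] using ih _ hr r.1 r.2 rfl

theorem X_sub_mem (i : ι) (m : Multiset ι) (h : G) :
    X b ρ B i (E m h) - E (i ::ₘ m) h ∈ fil ι G m.card := (deg_act b ρ B m h).1 i

theorem Γ_mem {n : ℕ} (g : G) {f : Mod ι G} (hf : f ∈ fil ι G n) : Γ b ρ B g f ∈ fil ι G n :=
  fil_le (N := (fil ι G n).comap (Γ b ρ B g))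
    (fun m h hm => fil_mono hm ((deg_act b ρ B m h).2 g)) hf

theorem X_mem {n : ℕ} (i : ι) {f : Mod ι G} (hf : f ∈ fil ι G n) :
    X b ρ B i f ∈ fil ι G (n + 1) := by
  refine fil_le (N := (fil ι G (n + 1)).comap (X b ρ B i)) (fun m h hm => ?_) hf
  have h₂ : E (i ::ₘ m) h ∈ fil ι G (n + 1) := E_mem_fil (by simpa using hm)
  simpa using add_mem (fil_mono (hm.trans n.le_succ) (X_sub_mem b ρ B i m h)) h₂

theorem XV_mem {n : ℕ} (v : V) {f : Mod ι G} (hf : f ∈ fil ι G n) :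
    XV b ρ B v f ∈ fil ι G (n + 1) := by
  refine apply_mem_of_basis b _ (fun i => ?_) v
  rw [XV_basis]
  exact X_mem b ρ B i hf

/-- The recursion formula for g with the truncation removed, which the degree bounds permit. -/
theorem Γ_cons {j : ι} {m : Multiset ι} (hj : ∀ k ∈ m, j ≤ k) (g h : G) :
    Γ b ρ B g (E (j ::ₘ m) h) = XV b ρ B (ρ g (b j)) (Γ b ρ B g (E m h)) := by
  have hE : E m h ∈ fil ι G m.card := E_mem_fil le_rfl
  rw [Γ, opG_E, act]
  simp only [step, Multiset.cons_ne_zero, dite_false, minElt_cons hj, Multiset.erase_cons_head,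
    Multiset.card_cons]
  rw [opG_trunc _ _ _ hE]
  exact vecOp_trunc b _ _ _ (Γ_mem b ρ B g hE)

/-- The straightening rule for a single inversion. -/
theorem X_cons {i j : ι} {m : Multiset ι} (hj : ∀ k ∈ m, j ≤ k) (hij : j < i) (h : G) :
    X b ρ B i (E (j ::ₘ m) h) =
      X b ρ B j (X b ρ B i (E m h)) + K b ρ B (B (b i) (b j)) (E m h) := by
  have hE : E m h ∈ fil ι G m.card := E_mem_fil le_rfl
  have hj' : ∀ k ∈ i ::ₘ m, j ≤ k := by
    intro k hk
    rcases Multiset.mem_cons.1 hk with rfl | hk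
    exacts [hij.le, hj k hk]
  have key : X b ρ B i (E (j ::ₘ m) h) = E (i ::ₘ j ::ₘ m) h +
      X b ρ B j (X b ρ B i (E m h) - E (i ::ₘ m) h) + K b ρ B (B (b i) (b j)) (E m h) := by
    rw [X, opX_E, act]
    simp only [step, Multiset.cons_ne_zero, dite_false, minElt_cons hj,
      Multiset.erase_cons_head, Multiset.card_cons, hij.not_ge, if_false]
    rw [opX_trunc _ _ _ hE, algOp_trunc _ _ _ hE]
    exact congrArg (_ + · + _) (opX_trunc _ _ _ (X_sub_mem b ρ B i m h))
  -- As j is least, applying b_j to the word of i and m gives exactly the leading word, which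
  -- cancels the subtracted term.
  rw [key, map_sub, X_of_le b ρ B hj', Multiset.cons_swap]
  abel

end PBW

/-! ### The defining relations hold on the normal form module -/

namespace PBW

section

variable {G V ι : Type*} [AddCommGroup V] [Module ℂ V] [Group G] [LinearOrder ι]
  (b : Module.Basis ι ℂ V) (ρ : Representation ℂ G V) (B : V →ₗ[ℂ] V →ₗ[ℂ] MonoidAlgebra ℂ G)

/-- The defining relations of `H_κ`, evaluated at `f`. -/
structure RelAt (f : Mod ι G) : Prop where
  comm : ∀ v w, XV b ρ B v (XV b ρ B w f) - XV b ρ B w (XV b ρ B v f) = K b ρ B (B v w) f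
  grp_vec : ∀ g v, Γ b ρ B g (XV b ρ B v f) = XV b ρ B (ρ g v) (Γ b ρ B g f)
  grp_mul : ∀ g h, Γ b ρ B g (Γ b ρ B h f) = Γ b ρ B (g * h) f

variable {b ρ B}

/-- Each relation is linear in the vector it is evaluated at, so basis words suffice. -/
theorem RelAt.of_fil {n : ℕ} (h : ∀ m g, m.card ≤ n → RelAt b ρ B (E m g)) {f : Mod ι G}
    (hf : f ∈ fil ι G n) : RelAt b ρ B f where
  comm v w := by
    have := eq_on_fil (φ := XV b ρ B v * XV b ρ B w - XV b ρ B w * XV b ρ B v)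
      (ψ := K b ρ B (B v w)) (fun m g hm => (h m g hm).comm v w) hf
    exact this
  grp_vec g v := by
    have := eq_on_fil (φ := Γ b ρ B g * XV b ρ B v) (ψ := XV b ρ B (ρ g v) * Γ b ρ B g)
      (fun m g' hm => (h m g' hm).grp_vec g v) hf
    exact this
  grp_mul g g' := by
    have := eq_on_fil (φ := Γ b ρ B g * Γ b ρ B g') (ψ := Γ b ρ B (g * g'))
      (fun m h' hm => (h m h' hm).grp_mul g g') hf
    exact this

theorem RelAt.grp_alg {f : Mod ι G} (hf : RelAt b ρ B f) (g : G) (a : MonoidAlgebra ℂ G) :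
    Γ b ρ B g (K b ρ B a f) = K b ρ B (MonoidAlgebra.single g 1 * a) f := by
  induction a using MonoidAlgebra.induction_linear with
  | zero => simp
  | add a a' h h' => simp only [map_add, mul_add, LinearMap.add_apply, h, h']
  | single h c =>
    rw [MonoidAlgebra.single_mul_single, one_mul, K_single, K_single, LinearMap.smul_apply,
      LinearMap.smul_apply, map_smul, hf.grp_mul]

theorem RelAt.alg_grp {f : Mod ι G} (hf : RelAt b ρ B f) (g : G) (a : MonoidAlgebra ℂ G) :
    K b ρ B a (Γ b ρ B g f) = K b ρ B (a * MonoidAlgebra.single g 1) f := by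
  induction a using MonoidAlgebra.induction_linear with
  | zero => simp
  | add a a' h h' => simp only [map_add, add_mul, LinearMap.add_apply, h, h']
  | single h c =>
    rw [MonoidAlgebra.single_mul_single, mul_one, K_single, K_single, LinearMap.smul_apply,
      LinearMap.smul_apply, hf.grp_mul]

theorem K_apply [Fintype G] (a : MonoidAlgebra ℂ G) (f : Mod ι G) :
    K b ρ B a f = ∑ g, a.coeff g • Γ b ρ B g f := by
  induction a using MonoidAlgebra.induction_linear with
  | zero => simp
  | add a a' h h' =>
    rw [map_add, LinearMap.add_apply, h, h', ← Finset.sum_add_distrib]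
    exact Finset.sum_congr rfl fun g _ => (add_smul _ _ _).symm
  | single h c =>
    classical
    rw [K_single, Finset.sum_eq_single h]
    · simp
    · intro g _ hg
      simp [hg.symm]
    · simp

/-- Term by term this is [g, v] = (gv - v) g. -/
theorem RelAt.alg_vec [Fintype G] {f : Mod ι G} (hf : RelAt b ρ B f) (a : MonoidAlgebra ℂ G)
    (v : V) :
    K b ρ B a (XV b ρ B v f) - XV b ρ B v (K b ρ B a f) =
      ∑ g, XV b ρ B (a.coeff g • (ρ g v - v)) (Γ b ρ B g f) := by
  rw [K_apply, K_apply, map_sum, ← Finset.sum_sub_distrib]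
  refine Finset.sum_congr rfl fun g _ => ?_
  rw [hf.grp_vec, map_smul, ← smul_sub, map_smul, map_sub]
  rfl

/-- The Jacobi identity for `κ`. -/
def Jacobi (ρ : Representation ℂ G V) (B : V →ₗ[ℂ] V →ₗ[ℂ] MonoidAlgebra ℂ G) : Prop :=
  ∀ g x y z, (B y z).coeff g • (ρ g x - x) + (B z x).coeff g • (ρ g y - y) +
    (B x y).coeff g • (ρ g z - z) = 0

theorem RelAt.jacobi [Fintype G] {f : Mod ι G} (hf : RelAt b ρ B f) (hJ : Jacobi ρ B)
    (x y z : V) :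
    (K b ρ B (B y z) (XV b ρ B x f) - XV b ρ B x (K b ρ B (B y z) f)) +
      (K b ρ B (B z x) (XV b ρ B y f) - XV b ρ B y (K b ρ B (B z x) f)) +
      (K b ρ B (B x y) (XV b ρ B z f) - XV b ρ B z (K b ρ B (B x y) f)) = 0 := by
  rw [hf.alg_vec, hf.alg_vec, hf.alg_vec, ← Finset.sum_add_distrib, ← Finset.sum_add_distrib]
  refine Finset.sum_eq_zero fun g _ => ?_
  rw [← LinearMap.add_apply, ← LinearMap.add_apply, ← map_add, ← map_add, hJ, map_zero,
    LinearMap.zero_apply]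

theorem le_of_forall_le_cons {i k : ι} {m : Multiset ι} (hk : ∀ l ∈ m, k ≤ l)
    (h : ¬ ∀ l ∈ k ::ₘ m, i ≤ l) : k < i := by
  by_contra! hik
  refine h fun l hl => ?_
  rcases Multiset.mem_cons.1 hl with rfl | hl
  exacts [hik, hik.trans (hk l hl)]

theorem forall_le_cons {j k : ι} {m : Multiset ι} (hk : ∀ l ∈ m, k ≤ l) (h : k ≤ j) :
    ∀ l ∈ j ::ₘ m, k ≤ l := by
  intro l hl
  rcases Multiset.mem_cons.1 hl with rfl | hl
  exacts [h, hk l hl]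

/-- The case of the commutation relation at `b_j b_{m}` for a pair `i > k` with `k ≤ j, m`. -/
theorem X_X_min {m : Multiset ι} {h : G}
    (ih : ∀ f ∈ fil ι G m.card, RelAt b ρ B f) {i j k : ι} (hk : ∀ l ∈ m, k ≤ l) (hi : k < i)
    (hj : k < j) :
    X b ρ B i (X b ρ B k (X b ρ B j (E m h))) =
      X b ρ B k (X b ρ B i (X b ρ B j (E m h))) +
        K b ρ B (B (b i) (b k)) (X b ρ B j (E m h)) := by
  -- Split b_j m into its leading word, where k is still least and the straightening rule applies,
  -- and a remainder of degree at most that of m, where the induction hypothesis applies.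
  have h₁ : X b ρ B j (E m h) = E (j ::ₘ m) h + (X b ρ B j (E m h) - E (j ::ₘ m) h) := by abel
  have hlow := (ih _ (X_sub_mem b ρ B j m h)).comm (b i) (b k)
  simp only [XV_basis] at hlow
  have hk' := forall_le_cons hk hj.le
  have htop : X b ρ B i (X b ρ B k (E (j ::ₘ m) h)) =
      X b ρ B k (X b ρ B i (E (j ::ₘ m) h)) + K b ρ B (B (b i) (b k)) (E (j ::ₘ m) h) := by
    rw [X_of_le b ρ B hk', X_cons b ρ B hk' hi]
  rw [h₁]
  generalize X b ρ B j (E m h) - E (j ::ₘ m) h = u at hlow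
  simp only [map_add, htop]
  rw [eq_add_of_sub_eq' hlow]
  abel

/-- If j is at most every letter, this is the straightening rule itself. Otherwise the word begins
with some k < j < i: both b_i and b_j are moved past b_k by `X_X_min`, and the inductive relation
for b_i, b_j is used behind b_k. What remains is the sum of the three commutators of κ with a
vector, zero by Jacobi. -/
theorem comm_of_lt [Fintype G] (hB : ∀ v, B v v = 0) (hJ : Jacobi ρ B) {m : Multiset ι} {h : G}
    (ih : ∀ m' h', m'.card < m.card → RelAt b ρ B (E m' h')) {i j : ι} (hij : j < i) :
    X b ρ B i (X b ρ B j (E m h)) - X b ρ B j (X b ρ B i (E m h)) =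
      K b ρ B (B (b i) (b j)) (E m h) := by
  by_cases hj : ∀ l ∈ m, j ≤ l
  · rw [X_of_le b ρ B hj, X_cons b ρ B hj hij, add_sub_cancel_left]
  rcases exists_cons_min m with rfl | ⟨k, m, hk, rfl⟩
  · simp at hj
  have hkj := le_of_forall_le_cons hk hj
  have hki := hkj.trans hij
  replace ih : ∀ f ∈ fil ι G m.card, RelAt b ρ B f := fun f hf =>
    RelAt.of_fil (fun m' g hm' => ih m' g (by simpa using Nat.lt_succ_of_le hm')) hf
  have hf := ih _ (E_mem_fil (le_refl m.card) (g := h))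
  have hJf := hf.jacobi hJ (b k) (b i) (b j)
  have hc := hf.comm (b i) (b j)
  have hBn : B (b k) (b i) = -B (b i) (b k) := by
    have := hB (b k + b i)
    simp only [map_add, LinearMap.add_apply, hB, zero_add, add_zero] at this
    exact eq_neg_of_add_eq_zero_left (by rwa [add_comm] at this)
  simp only [XV_basis, hBn, map_neg, LinearMap.neg_apply] at hJf hc
  rw [X_cons b ρ B hk hkj, X_cons b ρ B hk hki, map_add, map_add, X_X_min ih hk hki hkj,
    X_X_min ih hk hkj hki, ← X_of_le b ρ B hk, eq_add_of_sub_eq' hc, map_add]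
  rw [← sub_eq_zero, ← neg_eq_zero, ← hJf]
  abel

theorem grp_mul_of_lt {m : Multiset ι} {h : G}
    (ih : ∀ m' h', m'.card < m.card → RelAt b ρ B (E m' h')) (g g' : G) :
    Γ b ρ B g (Γ b ρ B g' (E m h)) = Γ b ρ B (g * g') (E m h) := by
  rcases exists_cons_min m with rfl | ⟨k, m, hk, rfl⟩
  · rw [Γ_zero, Γ_zero, Γ_zero, mul_assoc]
  replace ih : ∀ f ∈ fil ι G m.card, RelAt b ρ B f := fun f hf =>
    RelAt.of_fil (fun m' g hm' => ih m' g (by simpa using Nat.lt_succ_of_le hm')) hf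
  have hE : E m h ∈ fil ι G m.card := E_mem_fil le_rfl
  rw [Γ_cons b ρ B hk, Γ_cons b ρ B hk, (ih _ (Γ_mem b ρ B g' hE)).grp_vec, (ih _ hE).grp_mul,
    map_mul]
  rfl

/-- The overlap g b_i b_k with k < i. Straighten b_i b_k, move g through both letters, and
recombine: g κ(b_i, b_k) = κ(g b_i, g b_k) g is exactly the commutator of g b_i and g b_k needed to
restore their order. -/
theorem grp_vec_of_lt (hG : ∀ g x y, MonoidAlgebra.single g 1 * B x y =
      B (ρ g x) (ρ g y) * MonoidAlgebra.single g 1) {m : Multiset ι} {h : G}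
    (ih : ∀ m' h', m'.card < m.card → RelAt b ρ B (E m' h')) (g : G) (i : ι) :
    Γ b ρ B g (X b ρ B i (E m h)) = XV b ρ B (ρ g (b i)) (Γ b ρ B g (E m h)) := by
  by_cases hi : ∀ l ∈ m, i ≤ l
  · rw [X_of_le b ρ B hi, Γ_cons b ρ B hi]
  rcases exists_cons_min m with rfl | ⟨k, m, hk, rfl⟩
  · simp at hi
  have hki := le_of_forall_le_cons hk hi
  replace ih : ∀ f ∈ fil ι G m.card, RelAt b ρ B f := fun f hf =>
    RelAt.of_fil (fun m' g hm' => ih m' g (by simpa using Nat.lt_succ_of_le hm')) hf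
  have hE : E m h ∈ fil ι G m.card := E_mem_fil le_rfl
  have h₁ : X b ρ B i (E m h) = E (i ::ₘ m) h + (X b ρ B i (E m h) - E (i ::ₘ m) h) := by abel
  have hlow := (ih _ (X_sub_mem b ρ B i m h)).grp_vec g (b k)
  have hk' := forall_le_cons hk hki.le
  have key : Γ b ρ B g (X b ρ B k (X b ρ B i (E m h))) =
      XV b ρ B (ρ g (b k)) (Γ b ρ B g (X b ρ B i (E m h))) := by
    rw [XV_basis] at hlow
    rw [h₁]
    generalize X b ρ B i (E m h) - E (i ::ₘ m) h = u at hlow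
    rw [map_add, map_add, map_add, map_add, hlow, X_of_le b ρ B hk', Γ_cons b ρ B hk']
  have h₂ := (ih _ hE).grp_vec g (b i)
  rw [XV_basis] at h₂
  rw [X_cons b ρ B hk hki, map_add, key, h₂, Γ_cons b ρ B hk, (ih _ hE).grp_alg, hG,
    ← (ih _ hE).alg_grp, ← (ih _ (Γ_mem b ρ B g hE)).comm]
  abel

theorem relAt_E [Fintype G] (hB : ∀ v, B v v = 0) (hJ : Jacobi ρ B)
    (hG : ∀ g x y, MonoidAlgebra.single g 1 * B x y =
      B (ρ g x) (ρ g y) * MonoidAlgebra.single g 1) (m : Multiset ι) (h : G) :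
    RelAt b ρ B (E m h) := by
  induction hn : m.card using Nat.strong_induction_on generalizing m h with
  | _ n ih =>
    subst hn
    replace ih : ∀ m' h', m'.card < m.card → RelAt b ρ B (E m' h') := fun m' h' hm' =>
      ih _ hm' m' h' rfl
    refine ⟨fun v w => ?_, fun g v => ?_, grp_mul_of_lt ih⟩
    · let φ : V →ₗ[ℂ] V →ₗ[ℂ] Mod ι G :=
        ((LinearMap.mul ℂ (Module.End ℂ (Mod ι G))).compl₁₂ (XV b ρ B) (XV b ρ B)).compr₂
          (LinearMap.applyₗ (E m h))
      let ψ : V →ₗ[ℂ] V →ₗ[ℂ] Mod ι G := B.compr₂ (LinearMap.applyₗ (E m h) ∘ₗ K b ρ B)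
      have : φ = φ.flip + ψ := by
        refine LinearMap.ext_basis b b fun i j => ?_
        change XV b ρ B (b i) (XV b ρ B (b j) (E m h)) =
          XV b ρ B (b j) (XV b ρ B (b i) (E m h)) + K b ρ B (B (b i) (b j)) (E m h)
        rw [← sub_eq_iff_eq_add']
        rw [XV_basis, XV_basis]
        rcases lt_trichotomy j i with hij | rfl | hij
        · exact comm_of_lt hB hJ ih hij
        · simp [hB]
        · have hBn : B (b i) (b j) = -B (b j) (b i) := by
            have := hB (b i + b j)
            simp only [map_add, LinearMap.add_apply, hB, zero_add, add_zero] at this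
            exact eq_neg_of_add_eq_zero_left (by rwa [add_comm] at this)
          rw [hBn, map_neg, LinearMap.neg_apply, ← comm_of_lt hB hJ ih hij, neg_sub]
      exact sub_eq_iff_eq_add'.2 (LinearMap.congr_fun₂ this v w)
    · have : (Γ b ρ B g ∘ₗ LinearMap.applyₗ (E m h)) ∘ₗ XV b ρ B =
          LinearMap.applyₗ (Γ b ρ B g (E m h)) ∘ₗ XV b ρ B ∘ₗ ρ g := by
        refine b.ext fun i => ?_
        change Γ b ρ B g (XV b ρ B (b i) (E m h)) =
          XV b ρ B (ρ g (b i)) (Γ b ρ B g (E m h))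
        rw [XV_basis]
        exact grp_vec_of_lt hG ih g i
      exact LinearMap.congr_fun this v

theorem relAt [Fintype G] (hB : ∀ v, B v v = 0) (hJ : Jacobi ρ B)
    (hG : ∀ g x y, MonoidAlgebra.single g 1 * B x y =
      B (ρ g x) (ρ g y) * MonoidAlgebra.single g 1) (f : Mod ι G) : RelAt b ρ B f := by
  have hf : f ∈ fil ι G (f.support.sup fun p => p.1.card) := fun p hp =>
    Finset.le_sup (f := fun p : Multiset ι × G => p.1.card) hp
  exact RelAt.of_fil (fun m g _ => relAt_E hB hJ hG m g) hf

/-- The relations in `RelAt` make the identity of G act only as an idempotent, so its triviality is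
checked separately, letter by letter. -/
theorem Γ_one (f : Mod ι G) : Γ b ρ B 1 f = f := by
  have key : ∀ n, ∀ m : Multiset ι, m.card = n → ∀ h : G, Γ b ρ B 1 (E m h) = E m h := by
    intro n
    induction n with
    | zero =>
      intro m hm h
      rw [Multiset.card_eq_zero.1 hm, Γ_zero, one_mul]
    | succ n ih =>
      intro m hm h
      rcases exists_cons_min m with rfl | ⟨k, m, hk, rfl⟩
      · simp at hm
      · rw [Γ_cons b ρ B hk, ih m (by simpa using hm), map_one, Module.End.one_apply, XV_basis,
          X_of_le b ρ B hk]
  have : Γ b ρ B 1 = LinearMap.id :=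
    Finsupp.lhom_ext' fun p => LinearMap.ext_ring (key _ p.1 rfl p.2)
  rw [this, LinearMap.id_apply]

end

end PBW

/-! ### κ as an equivariant alternating bilinear form -/

namespace SRA
section
variable {G V : Type*} [Group G] [AddCommGroup V] [Module ℂ V] (ρ : Representation ℂ G V)
  (κ : ⋀[ℂ]^2 V →ₗ[ℂ] MonoidAlgebra ℂ G)

theorem update_left {W : Type*} (x y z : W) : Function.update ![x, y] 0 z = ![z, y] := by
  ext i
  fin_cases i <;> rfl

theorem update_right {W : Type*} (x y z : W) : Function.update ![x, y] 1 z = ![x, z] := by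
  ext i
  fin_cases i <;> rfl

/-- The bilinear form `(x, y) ↦ κ(x, y)`. -/
def bil : V →ₗ[ℂ] V →ₗ[ℂ] MonoidAlgebra ℂ G :=
  LinearMap.mk₂ ℂ (fun x y => κ (wedge x y))
    (fun x x' y => by
      rw [← map_add, wedge, wedge, wedge]
      congr 1
      have := (exteriorPower.ιMulti ℂ 2 (M := V)).map_update_add ![x, y] 0 x x'
      simpa only [update_left] using this)
    (fun c x y => by
      rw [← map_smul, wedge, wedge]
      congr 1
      have := (exteriorPower.ιMulti ℂ 2 (M := V)).map_update_smul ![x, y] 0 c x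
      simpa only [update_left] using this)
    (fun x y y' => by
      rw [← map_add, wedge, wedge, wedge]
      congr 1
      have := (exteriorPower.ιMulti ℂ 2 (M := V)).map_update_add ![x, y] 1 y y'
      simpa only [update_right] using this)
    (fun c x y => by
      rw [← map_smul, wedge, wedge]
      congr 1
      have := (exteriorPower.ιMulti ℂ 2 (M := V)).map_update_smul ![x, y] 1 c y
      simpa only [update_right] using this)

omit [Group G] in
theorem bil_apply (x y : V) : bil κ x y = κ (wedge x y) := rfl

theorem bil_self (x : V) : bil κ x x = 0 := by
  rw [bil_apply, wedge, (exteriorPower.ιMulti ℂ 2 (M := V)).map_eq_zero_of_eq ![x, x]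
    (i := 0) (j := 1) rfl (by decide), map_zero]

theorem bil_equivariant (hκ : ∀ g w, κ (exteriorPower.map 2 (ρ g) w) =
      MonoidAlgebra.single g 1 * κ w * MonoidAlgebra.single g⁻¹ 1) (g : G) (x y : V) :
    MonoidAlgebra.single g 1 * bil κ x y =
      bil κ (ρ g x) (ρ g y) * MonoidAlgebra.single g 1 := by
  have h : bil κ (ρ g x) (ρ g y) =
      MonoidAlgebra.single g 1 * κ (wedge x y) * MonoidAlgebra.single g⁻¹ 1 := by
    rw [← hκ, bil_apply, wedge, wedge, exteriorPower.map_apply_ιMulti]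
    congr 2
  rw [h, mul_assoc, MonoidAlgebra.single_mul_single, inv_mul_cancel, one_mul,
    ← MonoidAlgebra.one_def, mul_one, bil_apply]

theorem bil_coeff_conj (hκ : ∀ g w, κ (exteriorPower.map 2 (ρ g) w) =
      MonoidAlgebra.single g 1 * κ w * MonoidAlgebra.single g⁻¹ 1) (g h : G) (x y : V) :
    (bil κ (ρ g x) (ρ g y)).coeff (g * h * g⁻¹) = (bil κ x y).coeff h := by
  have := congrArg (fun a => a.coeff (g * h)) (bil_equivariant ρ κ hκ g x y)
  simp only [MonoidAlgebra.coeff_single_mul_apply, MonoidAlgebra.coeff_mul_single_apply] at this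
  simpa using this.symm

/-! ### Surjectivity of `ξ` -/

theorem H.filtration_succ (n : ℕ) : H.filtration ρ κ (n + 1) =
    (1 ⊔ LinearMap.range (H.vec ρ κ)) * H.filtration ρ κ n := by
  rw [H.filtration, H.filtration, pow_succ', mul_assoc]

theorem H.filtration_zero : H.filtration ρ κ 0 = LinearMap.range (H.grp ρ κ).toLinearMap := by
  rw [H.filtration, pow_zero, one_mul]

theorem H.filtration_le_succ (n : ℕ) : H.filtration ρ κ n ≤ H.filtration ρ κ (n + 1) := by
  rw [H.filtration_succ]
  exact (one_mul (H.filtration ρ κ n)).ge.trans (mul_le_mul' le_sup_left le_rfl)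

theorem H.vec_mul_mem {n : ℕ} (x : V) {a : H ρ κ} (ha : a ∈ H.filtration ρ κ n) :
    H.vec ρ κ x * a ∈ H.filtration ρ κ (n + 1) := by
  rw [H.filtration_succ]
  exact Submodule.mul_mem_mul (Submodule.mem_sup_right ⟨x, rfl⟩) ha

/-- Induction on the filtration of `H_κ`. -/
theorem H.filtration_induction {motive : ∀ n (a : H ρ κ), a ∈ H.filtration ρ κ n → Prop}
    (grp : ∀ g, motive 0 _ (H.grp_mem ρ κ (MonoidAlgebra.single g 1)))
    (add : ∀ n a b ha hb, motive n a ha → motive n b hb → motive n (a + b) (add_mem ha hb))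
    (smul : ∀ n (c : ℂ) a ha, motive n a ha → motive n (c • a) (Submodule.smul_mem _ c ha))
    (incl : ∀ n a ha, motive n a ha → motive (n + 1) a (H.filtration_le_succ ρ κ n ha))
    (vec : ∀ n x a ha, motive n a ha → motive (n + 1) (H.vec ρ κ x * a) (H.vec_mul_mem ρ κ x ha))
    (n : ℕ) (a : H ρ κ) (ha : a ∈ H.filtration ρ κ n) : motive n a ha := by
  induction n generalizing a with
  | zero =>
    have ha' := ha
    rw [H.filtration_zero] at ha'
    obtain ⟨u, rfl⟩ := ha'
    have h0 : motive 0 0 (zero_mem _) := by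
      have := smul 0 0 _ _ (grp 1)
      simpa using this
    induction u using MonoidAlgebra.induction_linear with
    | zero => simpa using h0
    | add u v hu hv =>
      simpa using add 0 _ _ _ _ (hu (H.grp_mem ρ κ u)) (hv (H.grp_mem ρ κ v))
    | single g c =>
      have := smul 0 c _ _ (grp g)
      simpa [← map_smul] using this
  | succ n ih =>
    have ha' := ha
    rw [H.filtration_succ] at ha'
    induction ha' using Submodule.mul_induction_on' with
    | mem_mul_mem p hp q hq =>
      obtain ⟨_, ⟨c, rfl⟩, _, ⟨x, rfl⟩, rfl⟩ := Submodule.mem_sup.1 hp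
      have h₁ := incl n _ _ (smul n c _ _ (ih q hq))
      have h₂ := vec n x _ _ (ih q hq)
      have := add _ _ _ _ _ h₁ h₂
      simpa [add_mul, Algebra.smul_def] using this
    | add a ha' b hb' iha ihb =>
      rw [← H.filtration_succ] at ha' hb'
      exact add _ _ _ _ _ (iha ha') (ihb hb')

/-- The filtration is built from G by left multiplication by V, and symbols are multiplicative, so
every symbol is a polynomial in those of V and G. -/
theorem xi_symbol (n : ℕ) (a : H ρ κ) (ha : a ∈ H.filtration ρ κ n) :
    AssocGr.symbol (H.filtration ρ κ) n ⟨a, ha⟩ ∈ (xi ρ κ).range := by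
  induction n, a, ha using H.filtration_induction with
  | grp g => exact ⟨_, xi_grp ρ κ g⟩
  | add n a b ha hb iha ihb =>
    have := add_mem iha ihb
    rwa [← map_add] at this
  | smul n c a ha iha =>
    have := Subalgebra.smul_mem _ iha c
    rwa [← map_smul] at this
  -- An element of F_n regarded in F_{n+1} has zero symbol.
  | incl n a ha iha =>
    have : AssocGr.symbol (H.filtration ρ κ) (n + 1) ⟨a, H.filtration_le_succ ρ κ n ha⟩ = 0 := by
      rw [AssocGr.symbol, LinearMap.comp_apply,
        (AssocGraded.cls_eq_zero_iff _).2 (AssocGraded.mem_below _ n.lt_succ_self ha), map_zero]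
    rw [this]
    exact zero_mem _
  | vec n x a ha iha =>
    have := mul_mem (⟨_, xi_vec ρ κ x⟩ : _ ∈ (xi ρ κ).range) iha
    rw [AssocGr.symbol_mul] at this
    convert this using 1
    exact AssocGr.symbol_congr _ (add_comm n 1) (by simp)

theorem xi_surjective : Function.Surjective (xi ρ κ) := by
  intro y
  change y ∈ (xi ρ κ).range
  induction y using DirectSum.induction_on with
  | zero => exact zero_mem _
  | of n p =>
    obtain ⟨⟨a, ha⟩, rfl⟩ := AssocGraded.cls_surjective _ n p
    exact xi_symbol ρ κ n a ha
  | add y z hy hz => exact add_mem hy hz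

end
end SRA

/-! ### Linear maps out of the associated graded space -/

namespace AssocGr

variable {A W : Type*} [Ring A] [Algebra ℂ A] [AddCommGroup W] [Module ℂ W]
  {F : ℕ → Submodule ℂ A}

/-- A linear map on `gr A` from linear maps on the `F_n` that vanish on `F_{<n}`. -/
def lift (f : ∀ n, F n →ₗ[ℂ] W)
    (hf : ∀ n (a : F n), (a : A) ∈ AssocGraded.below F n → f n a = 0) : AssocGr F →ₗ[ℂ] W :=
  DirectSum.toModule ℂ ℕ W fun n =>
    Submodule.liftQ ((AssocGraded.below F n).submoduleOf (F n)) (f n) fun a ha => hf n a ha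

theorem lift_symbol (f : ∀ n, F n →ₗ[ℂ] W)
    (hf : ∀ n (a : F n), (a : A) ∈ AssocGraded.below F n → f n a = 0) (n : ℕ) (a : F n) :
    lift f hf (symbol F n a) = f n a :=
  DirectSum.toModule_lof ℂ n (AssocGraded.cls F n a)

end AssocGr

namespace SRA

section

variable {G V ι : Type*} [Group G] [AddCommGroup V] [Module ℂ V] [LinearOrder ι]
  {b : Module.Basis ι ℂ V} {ρ : Representation ℂ G V}
  {κ : ⋀[ℂ]^2 V →ₗ[ℂ] MonoidAlgebra ℂ G} (hr : ∀ f, PBW.RelAt b ρ (bil κ) f)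

/-! ### The representation of `H_κ` on the normal form module -/

/-- The action of `G` on the normal form module. -/
def grpRep : G →* Module.End ℂ (PBW.Mod ι G) where
  toFun := PBW.Γ b ρ (bil κ)
  map_one' := LinearMap.ext PBW.Γ_one
  map_mul' g h := LinearMap.ext fun f => ((hr f).grp_mul g h).symm

/-- The action of `T(V)` on the normal form module. -/
def tensorRep (b : Module.Basis ι ℂ V) (ρ : Representation ℂ G V)
    (κ : ⋀[ℂ]^2 V →ₗ[ℂ] MonoidAlgebra ℂ G) : TensorRep ρ →ₐ[ℂ] Module.End ℂ (PBW.Mod ι G) :=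
  TensorAlgebra.lift ℂ (PBW.XV b ρ (bil κ))

theorem tensorRep_ι (x : V) :
    tensorRep b ρ κ (TensorRep.ι ρ x) = PBW.XV b ρ (bil κ) x :=
  TensorAlgebra.lift_ι_apply _ x

theorem tensorRep_smul (g : G) (a : TensorRep ρ) :
    tensorRep b ρ κ (g • a) * grpRep hr g = grpRep hr g * tensorRep b ρ κ a := by
  refine TensorAlgebra.induction (R := ℂ) (M := V) (C := fun a : TensorRep ρ =>
    tensorRep b ρ κ (g • a) * grpRep hr g = grpRep hr g * tensorRep b ρ κ a) ?_ ?_ ?_ ?_ a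
  · intro r
    change tensorRep b ρ κ (TensorRep.act ρ g (algebraMap ℂ (TensorRep ρ) r)) * _ =
      _ * tensorRep b ρ κ (algebraMap ℂ (TensorRep ρ) r)
    rw [AlgHom.commutes, AlgHom.commutes, Algebra.commutes]
  · intro x
    change tensorRep b ρ κ (g • TensorRep.ι ρ x) * _ = _ * tensorRep b ρ κ (TensorRep.ι ρ x)
    rw [TensorRep.smul_ι, tensorRep_ι, tensorRep_ι]
    exact LinearMap.ext fun f => ((hr f).grp_vec g x).symm
  · intro (a : TensorRep ρ) (a' : TensorRep ρ) ha hb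
    change tensorRep b ρ κ (g • (a * a')) * _ = _ * tensorRep b ρ κ (a * a')
    rw [smul_mul', map_mul, map_mul, mul_assoc, hb, ← mul_assoc, ha, mul_assoc]
  · intro (a : TensorRep ρ) (a' : TensorRep ρ) ha hb
    change tensorRep b ρ κ (g • (a + a')) * _ = _ * tensorRep b ρ κ (a + a')
    rw [smul_add, map_add, map_add, add_mul, mul_add, ha, hb]

/-- The action of `ℂ[G] ⋉ T(V)` on the normal form module. -/
def crossRep : TensorCross ρ →ₐ[ℂ] Module.End ℂ (PBW.Mod ι G) :=
  SkewMonoidAlgebra.liftNCAlgHom (tensorRep b ρ κ) (grpRep hr) (tensorRep_smul hr _ _)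

theorem crossRep_vec (x : V) : crossRep hr (TensorCross.vec ρ x) = PBW.XV b ρ (bil κ) x := by
  refine (SkewMonoidAlgebra.liftNC_single _ _ _ _).trans ?_
  rw [map_one, mul_one]
  exact tensorRep_ι x

theorem crossRep_grp (a : MonoidAlgebra ℂ G) :
    crossRep hr (TensorCross.grp ρ a) = PBW.K b ρ (bil κ) a := by
  induction a using MonoidAlgebra.induction_linear with
  | zero => simp
  | add a a' h h' => rw [map_add, map_add, map_add, h, h']
  | single g c =>
    rw [TensorCross.grp, MonoidAlgebra.lift_single, map_smul, PBW.K_single]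
    congr 1
    refine (SkewMonoidAlgebra.liftNC_single _ _ _ _).trans ?_
    refine Eq.trans ?_ (one_mul _)
    exact congrArg (· * _) (map_one (tensorRep b ρ κ))

/-- The action of `H_κ` on the normal form module. -/
def H.rep : H ρ κ →ₐ[ℂ] Module.End ℂ (PBW.Mod ι G) :=
  RingQuot.liftAlgHom ℂ ⟨crossRep hr, by
    rintro _ _ ⟨x, y⟩
    rw [map_sub, map_mul, map_mul, crossRep_vec, crossRep_vec, crossRep_grp]
    exact LinearMap.ext fun f => (hr f).comm x y⟩

theorem H.rep_vec (x : V) : H.rep hr (H.vec ρ κ x) = PBW.XV b ρ (bil κ) x := by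
  rw [← crossRep_vec hr]
  exact RingQuot.liftAlgHom_mkAlgHom_apply ℂ _ _ _

theorem H.rep_grp (a : MonoidAlgebra ℂ G) :
    H.rep hr (H.grp ρ κ a) = PBW.K b ρ (bil κ) a := by
  rw [← crossRep_grp hr]
  exact RingQuot.liftAlgHom_mkAlgHom_apply ℂ _ _ _

/-- The action of `H_κ` on the empty word. -/
def H.normal : H ρ κ →ₗ[ℂ] PBW.Mod ι G :=
  LinearMap.applyₗ (PBW.E 0 1) ∘ₗ (H.rep hr).toLinearMap

theorem H.normal_vec_mul (x : V) (a : H ρ κ) :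
    H.normal hr (H.vec ρ κ x * a) = PBW.XV b ρ (bil κ) x (H.normal hr a) := by
  change H.rep hr (H.vec ρ κ x * a) _ = _
  rw [map_mul, H.rep_vec]
  rfl

theorem H.normal_grp (g : G) :
    H.normal hr (H.grp ρ κ (MonoidAlgebra.single g 1)) = PBW.E 0 g := by
  change H.rep hr (H.grp ρ κ (MonoidAlgebra.single g 1)) _ = _
  rw [H.rep_grp, PBW.K_single, one_smul, PBW.Γ_zero, mul_one]

theorem H.normal_mem (n : ℕ) (a : H ρ κ) (ha : a ∈ H.filtration ρ κ n) :
    H.normal hr a ∈ PBW.fil ι G n := by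
  induction n, a, ha using H.filtration_induction with
  | grp g =>
    rw [H.normal_grp]
    exact PBW.E_mem_fil le_rfl
  | add n a a' _ _ iha ihb => rw [map_add]; exact add_mem iha ihb
  | smul n c a _ iha => rw [map_smul]; exact Submodule.smul_mem _ _ iha
  | incl n a _ iha => exact PBW.fil_mono n.le_succ iha
  | vec n x a _ iha =>
    rw [H.normal_vec_mul]
    exact PBW.XV_mem b ρ _ x iha

/-- The homogeneous component of degree `n` of the normal form. -/
def H.normalTop (n : ℕ) : H.filtration ρ κ n →ₗ[ℂ] PBW.Mod ι G :=
  (Submodule.subtype _ ∘ₗ Finsupp.restrictDom ℂ ℂ {p : Multiset ι × G | p.1.card = n}) ∘ₗ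
    H.normal hr ∘ₗ Submodule.subtype _

theorem H.normalTop_eq_zero {n : ℕ} {a : H.filtration ρ κ n}
    (ha : (a : H ρ κ) ∈ AssocGraded.below (H.filtration ρ κ) n) : H.normalTop hr n a = 0 := by
  have h : AssocGraded.below (H.filtration ρ κ) n ≤
      (Finsupp.supported ℂ ℂ {p : Multiset ι × G | p.1.card < n}).comap (H.normal hr) :=
    iSup_le fun m => iSup_le fun hm x hx p hp => lt_of_le_of_lt (H.normal_mem hr m x hx hp) hm
  have h' := h ha
  rw [Submodule.mem_comap, Finsupp.mem_supported'] at h'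
  ext p
  by_cases hp : p.1.card = n
  · simpa [H.normalTop, Finsupp.restrictDom_apply, hp] using h' p (by simp [hp])
  · simp [H.normalTop, Finsupp.restrictDom_apply, hp]

/-- The symbol of the normal form, `gr H_κ → M`. -/
def GrH.normal : GrH ρ κ →ₗ[ℂ] PBW.Mod ι G :=
  AssocGr.lift (H.normalTop hr) fun _ _ ha => H.normalTop_eq_zero hr ha

theorem GrH.normal_symbol (n : ℕ) (a : H.filtration ρ κ n) :
    GrH.normal hr (AssocGr.symbol (H.filtration ρ κ) n a) = H.normalTop hr n a :=
  AssocGr.lift_symbol _ _ n a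

/-- The normal word `b_{i₁} ⋯ b_{i_k} g` of `ℂ[G] ⋉ S(V)`. -/
def word (b : Module.Basis ι ℂ V) (ρ : Representation ℂ G V) (m : Multiset ι) (g : G) :
    SymCross ρ :=
  SkewMonoidAlgebra.single g (m.map fun i => SymRep.ι ρ (b i)).prod

omit [LinearOrder ι] in
theorem word_cons (m : Multiset ι) (g : G) (i : ι) : word b ρ (i ::ₘ m) g =
    SkewMonoidAlgebra.single 1 (SymRep.ι ρ (b i)) * word b ρ m g := by
  rw [word, word, SkewMonoidAlgebra.single_mul_single, one_smul, one_mul, Multiset.map_cons,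
    Multiset.prod_cons]

/-- Build the word by adding least letters on the left: at each stage b_k acts by plain insertion,
so no correction terms arise and the lift to H_κ has the word itself as normal form. -/
theorem xi_word (m : Multiset ι) (g : G) : ∃ a : H.filtration ρ κ m.card,
    xi ρ κ (word b ρ m g) = AssocGr.symbol (H.filtration ρ κ) m.card a ∧
      H.normal hr a = PBW.E m g := by
  induction hn : m.card generalizing m with
  | zero =>
    obtain rfl := Multiset.card_eq_zero.1 hn
    exact ⟨⟨_, H.grp_mem ρ κ (MonoidAlgebra.single g 1)⟩, xi_grp ρ κ g, H.normal_grp hr g⟩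
  | succ n ih =>
    rcases PBW.exists_cons_min m with rfl | ⟨k, m, hk, rfl⟩
    · simp at hn
    obtain ⟨⟨a, ha⟩, h₁, h₂⟩ := ih m (by simpa using hn)
    refine ⟨⟨H.vec ρ κ (b k) * a, H.vec_mul_mem ρ κ _ ha⟩, ?_, ?_⟩
    · rw [word_cons, map_mul, h₁, xi_vec, AssocGr.symbol_mul]
      exact AssocGr.symbol_congr _ (add_comm 1 n) (by simp)
    · change H.normal hr (H.vec ρ κ (b k) * a) = _
      change H.normal hr a = _ at h₂
      rw [H.normal_vec_mul, h₂, PBW.XV_basis, PBW.X_of_le _ _ _ hk]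

/-- The linear map from the normal form module to `ℂ[G] ⋉ S(V)`. -/
def wordMap (b : Module.Basis ι ℂ V) (ρ : Representation ℂ G V) :
    PBW.Mod ι G →ₗ[ℂ] SymCross ρ :=
  Finsupp.linearCombination ℂ fun p => word b ρ p.1 p.2

omit [LinearOrder ι] in
-- Under SV ≅ ℂ[b_i] the normal words are the monomials times group elements. Only spanning is
-- needed; independence follows from `normal_xi_wordMap`.
theorem wordMap_surjective : Function.Surjective (wordMap b ρ) := by
  have key : ∀ (g : G) (a : SymRep ρ),
      SkewMonoidAlgebra.single g a ∈ LinearMap.range (wordMap b ρ) := by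
    intro g a
    let e : SymRep ρ ≃ₐ[ℂ] MvPolynomial ι ℂ := SymmetricAlgebra.equivMvPolynomial b
    obtain ⟨p, rfl⟩ := e.symm.surjective a
    induction p using MvPolynomial.induction_on' with
    | monomial u c =>
      refine ⟨c • PBW.E (Finsupp.toMultiset u) g, ?_⟩
      have h : e.symm (MvPolynomial.monomial u c) =
          c • ((Finsupp.toMultiset u).map fun i => SymmetricAlgebra.ι ℂ V (b i)).prod := by
        rw [MvPolynomial.monomial_eq, MvPolynomial.C_mul', map_smul, Finsupp.toMultiset_map,
          Finsupp.prod_toMultiset, Finsupp.prod_mapDomain_index (fun _ => pow_zero _)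
          (fun _ _ _ => pow_add _ _ _),
          map_finsuppProd]
        simp only [map_pow]
        refine congrArg (c • ·) (Finsupp.prod_congr fun i _ => ?_)
        exact congrArg (· ^ _) (SymmetricAlgebra.equivMvPolynomial_symm_X b i)
      rw [map_smul, wordMap, Finsupp.linearCombination_single, one_smul, word,
        SkewMonoidAlgebra.smul_single]
      exact congrArg _ h.symm
    | add p q hp hq =>
      rw [map_add, SkewMonoidAlgebra.single_add]
      exact add_mem hp hq
  intro a
  change a ∈ LinearMap.range (wordMap b ρ)
  exact SkewMonoidAlgebra.induction_on' a key fun _ _ h h' => add_mem h h'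

theorem normal_xi_wordMap (f : PBW.Mod ι G) :
    GrH.normal hr (xi ρ κ (wordMap b ρ f)) = f := by
  have : GrH.normal hr ∘ₗ (xi ρ κ).toLinearMap ∘ₗ wordMap b ρ = LinearMap.id := by
    refine Finsupp.lhom_ext' fun p => LinearMap.ext_ring ?_
    obtain ⟨a, h₁, h₂⟩ := xi_word hr p.1 p.2
    change GrH.normal hr (xi ρ κ (wordMap b ρ (Finsupp.single p 1))) = Finsupp.single p 1
    rw [wordMap, Finsupp.linearCombination_single, one_smul, h₁, GrH.normal_symbol]
    change (Finsupp.restrictDom ℂ ℂ _ (H.normal hr a) : PBW.Mod ι G) = _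
    rw [h₂, Finsupp.restrictDom_apply]
    exact Finsupp.filter_single_of_pos _ rfl
  exact LinearMap.congr_fun this f

theorem xi_injective_of_relAt (hr : ∀ f, PBW.RelAt b ρ (bil κ) f) :
    Function.Injective (xi ρ κ) := by
  rw [injective_iff_map_eq_zero]
  intro a ha
  obtain ⟨f, rfl⟩ := wordMap_surjective (b := b) a
  rw [← normal_xi_wordMap hr f, ha, map_zero, map_zero]

end

end SRA

namespace SRA

section

variable {G V : Type*} [Group G] [AddCommGroup V] [Module ℂ V] (ρ : Representation ℂ G V)
  (κ : ⋀[ℂ]^2 V →ₗ[ℂ] MonoidAlgebra ℂ G)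

/-! ### The Jacobi identity from the injectivity of `ξ` -/

section

variable {A : Type*} [Ring A] [Algebra ℂ A] [Fintype G] {γ : MonoidAlgebra ℂ G →ₐ[ℂ] A}
  {vec : V →ₗ[ℂ] A}

theorem grp_mul_vec_sub (h : ∀ g x, γ (MonoidAlgebra.single g 1) * vec x =
      vec (ρ g x) * γ (MonoidAlgebra.single g 1)) (a : MonoidAlgebra ℂ G) (v : V) :
    γ a * vec v - vec v * γ a =
      ∑ g, vec (a.coeff g • (ρ g v - v)) * γ (MonoidAlgebra.single g 1) := by
  have ha : a = ∑ g, a.coeff g • MonoidAlgebra.single g (1 : ℂ) := by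
    apply MonoidAlgebra.coeff_injective
    ext x
    classical
    simp [MonoidAlgebra.coeff_sum]
  conv_lhs => rw [ha]
  simp only [map_sum, map_smul, Finset.sum_mul, Finset.mul_sum, ← Finset.sum_sub_distrib]
  refine Finset.sum_congr rfl fun g _ => ?_
  rw [smul_mul_assoc, mul_smul_comm, h, ← smul_sub, ← sub_mul, ← map_sub, smul_mul_assoc]

/-- The Jacobi identity in an algebra that satisfies the relations of `H_κ`. -/
theorem sum_vec_mul_grp_eq_zero (h : ∀ g x, γ (MonoidAlgebra.single g 1) * vec x =
      vec (ρ g x) * γ (MonoidAlgebra.single g 1))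
    (hc : ∀ x y, vec x * vec y - vec y * vec x = γ (bil κ x y)) (x y z : V) :
    ∑ g, vec ((bil κ y z).coeff g • (ρ g x - x) + (bil κ z x).coeff g • (ρ g y - y) +
      (bil κ x y).coeff g • (ρ g z - z)) * γ (MonoidAlgebra.single g 1) = 0 := by
  -- Read from right to left, `grp_mul_vec_sub` turns the sum into [[y,z],x] + [[z,x],y] +
  -- [[x,y],z].
  simp only [map_add, add_mul, Finset.sum_add_distrib, ← grp_mul_vec_sub ρ h, ← hc]
  noncomm_ring

end

/-- Linear functionals on V extend to SV, and they separate vectors. -/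
theorem SymRep.ι_injective : Function.Injective (SymRep.ι ρ) := by
  rw [injective_iff_map_eq_zero]
  intro v hv
  rw [← Module.forall_dual_apply_eq_zero_iff ℂ]
  intro φ
  have := congrArg (SymmetricAlgebra.lift φ) hv
  exact (SymmetricAlgebra.lift_ι_apply (f := φ) v).symm.trans (this.trans (map_zero _))

/-- The relation Σ w_g g = 0 in H_κ would be a collapse in degree 1 that ℂ[G] ⋉ SV does not have,
unless all w_g vanish. -/
theorem jacobi_of_xi_injective [Fintype G] (h : Function.Injective (xi ρ κ)) :
    PBW.Jacobi ρ (bil κ) := by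
  intro g x y z
  let w : G → V := fun g => (bil κ y z).coeff g • (ρ g x - x) +
    (bil κ z x).coeff g • (ρ g y - y) + (bil κ x y).coeff g • (ρ g z - z)
  have hterm : ∀ g, xi ρ κ (SkewMonoidAlgebra.single g (SymRep.ι ρ (w g))) =
      AssocGr.symbol (H.filtration ρ κ) (1 + 0)
        ⟨H.vec ρ κ (w g) * H.grp ρ κ (MonoidAlgebra.single g 1),
          SetLike.mul_mem_graded (H.vec_mem ρ κ (w g)) (H.grp_mem ρ κ _)⟩ := by
    intro g
    have h₁ : SkewMonoidAlgebra.single g (SymRep.ι ρ (w g)) =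
        SkewMonoidAlgebra.single 1 (SymRep.ι ρ (w g)) * SkewMonoidAlgebra.single g 1 := by
      rw [SkewMonoidAlgebra.single_mul_single, one_smul, mul_one, one_mul]
    rw [h₁, map_mul, xi_vec, xi_grp, AssocGr.symbol_mul]
  have hsum : ∑ g, SkewMonoidAlgebra.single g (SymRep.ι ρ (w g)) = 0 := by
    apply h
    rw [map_sum, map_zero, Finset.sum_congr rfl fun g _ => hterm g, ← map_sum, ← map_zero
      (AssocGr.symbol (H.filtration ρ κ) (1 + 0))]
    congr 1
    ext
    rw [Submodule.coe_sum]
    exact sum_vec_mul_grp_eq_zero ρ κ (H.grp_mul_vec ρ κ) (H.comm ρ κ) x y z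
  let φ : SymCross ρ →+ SymRep ρ :=
    { toFun := fun a => a.coeff g
      map_zero' := rfl
      map_add' := fun a b => by rw [SkewMonoidAlgebra.coeff_add, Finsupp.add_apply] }
  have hg := congrArg φ hsum
  rw [map_sum, map_zero] at hg
  classical
  have hg' : ∑ g', (SkewMonoidAlgebra.single g' (SymRep.ι ρ (w g'))).coeff g = 0 := hg
  simp only [SkewMonoidAlgebra.coeff_single_apply, Finset.sum_ite_eq', Finset.mem_univ,
    if_true] at hg'
  exact SymRep.ι_injective ρ (hg'.trans (map_zero (SymRep.ι ρ)).symm)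

end

/-! ### Linear algebra of symplectic reflections -/

section

theorem alt_apply_of_basis {W : Type*} [AddCommGroup W] [Module ℂ W]
    (e : Module.Basis (Fin 2) ℂ W) {β : LinearMap.BilinForm ℂ W} (hβ : β.IsAlt) (x y : W) :
    β x y = (e.repr x 0 * e.repr y 1 - e.repr x 1 * e.repr y 0) * β (e 0) (e 1) := by
  conv_lhs => rw [← e.sum_repr x, ← e.sum_repr y]
  simp only [Fin.sum_univ_two, map_add, map_smul, LinearMap.add_apply, LinearMap.smul_apply,
    smul_eq_mul, hβ.self_eq_zero]
  rw [← hβ.neg_eq (e 0) (e 1)]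
  ring

/-- On a plane, a trilinear alternating expression vanishes. -/
theorem cyclic_sum_eq_zero {W : Type*} [AddCommGroup W] [Module ℂ W]
    (hW : Module.finrank ℂ W = 2) {β : LinearMap.BilinForm ℂ W} (hβ : β.IsAlt) (u v w : W) :
    β v w • u + β w u • v + β u v • w = 0 := by
  have : Module.Finite ℂ W := Module.finite_of_finrank_pos (by omega)
  let e := Module.finBasisOfFinrankEq ℂ W hW
  apply e.ext_elem
  intro i
  rw [alt_apply_of_basis e hβ v w, alt_apply_of_basis e hβ w u, alt_apply_of_basis e hβ u v]
  simp only [map_add, map_smul, map_zero, Finsupp.add_apply,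
    Finsupp.smul_apply, Finsupp.zero_apply, smul_eq_mul]
  fin_cases i <;> simp only [Fin.zero_eta, Fin.mk_one] <;> ring

/-- Alternating forms on a plane are proportional. -/
theorem exists_eq_mul_of_finrank_eq_two {W : Type*} [AddCommGroup W] [Module ℂ W]
    (hW : Module.finrank ℂ W = 2) {β ω : LinearMap.BilinForm ℂ W} (hβ : β.IsAlt) (hω : ω.IsAlt)
    (hω₀ : ω ≠ 0) : ∃ c : ℂ, ∀ x y, β x y = c * ω x y := by
  have : Module.Finite ℂ W := Module.finite_of_finrank_pos (by omega)
  let e := Module.finBasisOfFinrankEq ℂ W hW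
  have h0 : ω (e 0) (e 1) ≠ 0 := fun h => hω₀ <| LinearMap.ext₂ fun x y => by
    rw [alt_apply_of_basis e hω, h, mul_zero]
    rfl
  refine ⟨β (e 0) (e 1) / ω (e 0) (e 1), fun x y => ?_⟩
  rw [alt_apply_of_basis e hω x y, alt_apply_of_basis e hβ x y]
  field_simp

variable {G V : Type*} [Group G] [AddCommGroup V] [Module ℂ V] {ρ : Representation ℂ G V}
  {ω : LinearMap.BilinForm ℂ V}

theorem range_orthogonal_ker (hω : ∀ g x y, ω (ρ g x) (ρ g y) = ω x y) {g : G} {x k : V}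
    (hx : x ∈ LinearMap.range (1 - ρ g)) (hk : k ∈ LinearMap.ker (1 - ρ g)) : ω x k = 0 := by
  obtain ⟨v, rfl⟩ := hx
  have hk' : ρ g k = k := (sub_eq_zero.1 hk).symm
  have := hω g v k
  rw [hk'] at this
  change ω (v - ρ g v) k = 0
  rw [map_sub, LinearMap.sub_apply, this, sub_self]

variable [Finite G] [FiniteDimensional ℂ V]

/-- V is the orthogonal sum of the image and kernel of 1 - g, so ω stays nondegenerate on the image.
-/
theorem eq_zero_of_range_orthogonal (hω_nondeg : ω.Nondegenerate)
    (hω : ∀ g x y, ω (ρ g x) (ρ g y) = ω x y) {g : G} {x : V}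
    (hx : x ∈ LinearMap.range (1 - ρ g))
    (h : ∀ y ∈ LinearMap.range (1 - ρ g), ω x y = 0) : x = 0 := by
  refine hω_nondeg.1 x fun y => ?_
  have hy : y ∈ LinearMap.range (1 - ρ g) ⊔ LinearMap.ker (1 - ρ g) := by
    rw [(isCompl_range_ker ρ g).sup_eq_top]
    trivial
  obtain ⟨r, hr, k, hk, rfl⟩ := Submodule.mem_sup.1 hy
  rw [map_add, h r hr, range_orthogonal_ker hω hx hk, add_zero]

omit [Finite G] [FiniteDimensional ℂ V] in
theorem range_sub_one (ρ : Representation ℂ G V) (g : G) :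
    LinearMap.range (ρ g - 1) = LinearMap.range (1 - ρ g) := by
  rw [← neg_sub, LinearMap.range_neg]

/-- An alternating form vanishes on a line, whereas ω is nondegenerate on the image. -/
theorem two_le_finrank_range (hω_alt : ω.IsAlt) (hω_nondeg : ω.Nondegenerate)
    (hω : ∀ g x y, ω (ρ g x) (ρ g y) = ω x y) {g : G} (hg : ρ g ≠ 1) :
    2 ≤ Module.finrank ℂ (LinearMap.range (ρ g - 1)) := by
  by_contra! hlt
  refine hg (sub_eq_zero.1 (LinearMap.range_eq_bot.1 ?_))
  rw [range_sub_one] at hlt ⊢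
  obtain ⟨e, he⟩ := finrank_le_one_iff.1 (Nat.lt_succ_iff.1 hlt)
  refine (Submodule.eq_bot_iff _).2 fun x hx => eq_zero_of_range_orthogonal hω_nondeg hω hx ?_
  intro y hy
  obtain ⟨a, ha⟩ := he ⟨x, hx⟩
  obtain ⟨c, hc⟩ := he ⟨y, hy⟩
  have hx' : a • (e : V) = x := congrArg Subtype.val ha
  have hy' : c • (e : V) = y := congrArg Subtype.val hc
  rw [← hx', ← hy']
  simp [hω_alt.self_eq_zero]

/-- The projection to the image of `1 - s` along its kernel. -/
abbrev proj (ρ : Representation ℂ G V) (s : G) : V →ₗ[ℂ] V :=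
  (LinearMap.range (1 - ρ s)).projection (LinearMap.ker (1 - ρ s)) (isCompl_range_ker ρ s)

theorem proj_mem (s : G) (x : V) : proj ρ s x ∈ LinearMap.range (1 - ρ s) :=
  Submodule.projection_apply_mem _ _

theorem sub_proj_mem (s : G) (x : V) : x - proj ρ s x ∈ LinearMap.ker (1 - ρ s) := by
  rw [← Submodule.ker_projection (isCompl_range_ker ρ s), LinearMap.mem_ker, map_sub]
  exact sub_eq_zero.2 (Submodule.projection_apply_of_mem_left _ (proj_mem s x)).symm

theorem proj_eq_of_mem {s : G} {x : V} (hx : x ∈ LinearMap.range (1 - ρ s)) : proj ρ s x = x :=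
  Submodule.projection_apply_of_mem_left _ hx

theorem proj_conj (g s : G) (x : V) : proj ρ (g * s * g⁻¹) (ρ g x) = ρ g (proj ρ s x) := by
  have hconj : ∀ v, ρ (g * s * g⁻¹) (ρ g v) = ρ g (ρ s v) := by
    intro v
    rw [← Module.End.mul_apply, ← map_mul, inv_mul_cancel_right, map_mul]
    rfl
  have h₁ : ρ g (proj ρ s x) ∈ LinearMap.range (1 - ρ (g * s * g⁻¹)) := by
    obtain ⟨v, hv⟩ := proj_mem (ρ := ρ) s x
    refine ⟨ρ g v, ?_⟩
    rw [← hv]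
    change ρ g v - ρ (g * s * g⁻¹) (ρ g v) = ρ g (v - ρ s v)
    rw [hconj, map_sub]
  have h₂ : ρ g (x - proj ρ s x) ∈ LinearMap.ker (1 - ρ (g * s * g⁻¹)) := by
    have := sub_proj_mem (ρ := ρ) s x
    rw [LinearMap.mem_ker, LinearMap.sub_apply, Module.End.one_apply] at this ⊢
    rw [hconj, ← map_sub, this, map_zero]
  have h₃ : proj ρ (g * s * g⁻¹) (ρ g (x - proj ρ s x)) = 0 :=
    Submodule.projection_apply_of_mem_right _ h₂
  rw [map_sub, map_sub, sub_eq_zero, proj_eq_of_mem h₁] at h₃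
  exact h₃

theorem apply_sub_self (s : G) (x : V) : ρ s x - x = (ρ s - 1) (proj ρ s x) := by
  have := sub_proj_mem (ρ := ρ) s x
  rw [LinearMap.mem_ker, map_sub, sub_eq_zero] at this
  change x - ρ s x = _ at this
  rw [← neg_sub, this, ← neg_sub (1 : Module.End ℂ V), LinearMap.neg_apply]

theorem reflForm_conj (hω : ∀ g x y, ω (ρ g x) (ρ g y) = ω x y) (g s : G) (x y : V) :
    reflForm ρ ω (g * s * g⁻¹) (ρ g x) (ρ g y) = reflForm ρ ω s x y := by
  change ω (proj ρ _ _) (proj ρ _ _) = ω (proj ρ _ _) (proj ρ _ _)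
  rw [proj_conj, proj_conj, hω]

/-- The identity underlying the Jacobi identity for the form `ω_s`. -/
theorem reflForm_cyclic (hω_alt : ω.IsAlt) {s : G} (hs : s ∈ symplecticReflections ρ)
    (x y z : V) : reflForm ρ ω s y z • (ρ s x - x) + reflForm ρ ω s z x • (ρ s y - y) +
      reflForm ρ ω s x y • (ρ s z - z) = 0 := by
  have hs' : Module.finrank ℂ (LinearMap.range (1 - ρ s)) = 2 := by
    rw [← range_sub_one]
    exact hs
  have h := cyclic_sum_eq_zero hs' (β := ω.restrict _) (fun v => hω_alt.self_eq_zero v)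
    ⟨_, proj_mem s x⟩ ⟨_, proj_mem s y⟩ ⟨_, proj_mem s z⟩
  have h' : reflForm ρ ω s y z • proj ρ s x + reflForm ρ ω s z x • proj ρ s y +
      reflForm ρ ω s x y • proj ρ s z = 0 := congrArg Subtype.val h
  -- The plane identity concerns projections; s - 1 kills the complementary components, so it sends
  -- the projection of x to sx - x.
  have h₂ := congrArg (ρ s - 1 : Module.End ℂ V) h'
  rw [map_add, map_add, map_smul, map_smul, map_smul, map_zero] at h₂
  rw [apply_sub_self, apply_sub_self, apply_sub_self]
  exact h₂

theorem reflForm_ne_zero (hω_nondeg : ω.Nondegenerate)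
    (hω : ∀ g x y, ω (ρ g x) (ρ g y) = ω x y) {s : G} (hs : s ∈ symplecticReflections ρ) :
    ∃ x ∈ LinearMap.range (1 - ρ s), ∃ y ∈ LinearMap.range (1 - ρ s), ω x y ≠ 0 := by
  by_contra! h
  have hbot : LinearMap.range (1 - ρ s) = ⊥ := (Submodule.eq_bot_iff _).2 fun x hx =>
    eq_zero_of_range_orthogonal hω_nondeg hω hx (h x hx)
  have hs' : Module.finrank ℂ (LinearMap.range (ρ s - 1)) = 2 := hs
  rw [range_sub_one, hbot, finrank_bot] at hs'
  exact two_ne_zero hs'.symm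

/-! ### Solutions of the Jacobi identity -/

section

variable {β : LinearMap.BilinForm ℂ V} {g : G}

omit [Finite G] in
theorem exists_apply_sub_notMem {u v : V} {n : ℕ}
    (hn : Module.finrank ℂ (Submodule.span ℂ {u, v}) ≤ n)
    (h : n < Module.finrank ℂ (LinearMap.range (ρ g - 1))) :
    ∃ x, ρ g x - x ∉ Submodule.span ℂ {u, v} := by
  by_contra! hx
  refine (hn.trans_lt h).not_ge (Submodule.finrank_mono ?_)
  rintro _ ⟨x, rfl⟩
  exact hx x

omit [Finite G] [FiniteDimensional ℂ V] in
theorem finrank_span_pair_le (u v : V) : Module.finrank ℂ (Submodule.span ℂ {u, v}) ≤ 2 := by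
  classical
  have := finrank_span_finset_le_card (R := ℂ) ({u, v} : Finset V)
  rw [Finset.coe_pair] at this
  exact this.trans Finset.card_le_two

omit [Finite G] in
-- For given y, z some gx - x lies outside the span of gy - y and gz - z, so its coefficient β(y,z)
-- must vanish.
theorem form_eq_zero_of_three_le (hβ : ∀ x y z, β y z • (ρ g x - x) + β z x • (ρ g y - y) +
      β x y • (ρ g z - z) = 0) (h : 3 ≤ Module.finrank ℂ (LinearMap.range (ρ g - 1))) : β = 0 := by
  refine LinearMap.ext₂ fun y z => ?_
  obtain ⟨x, hx⟩ := exists_apply_sub_notMem (u := ρ g y - y) (v := ρ g z - z)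
    (finrank_span_pair_le _ _) h
  by_contra h0
  refine hx ((Submodule.smul_mem_iff _ h0).1 ?_)
  rw [Submodule.mem_span_pair]
  refine ⟨-β z x, -β x y, ?_⟩
  have := hβ x y z
  rw [add_assoc] at this
  rw [eq_neg_of_add_eq_zero_left this, neg_add, neg_smul, neg_smul]

omit [Finite G] in
theorem form_eq_zero_of_mem_ker (hβ : ∀ x y z, β y z • (ρ g x - x) + β z x • (ρ g y - y) +
      β x y • (ρ g z - z) = 0) (h : 2 ≤ Module.finrank ℂ (LinearMap.range (ρ g - 1))) {x : V}
    (hx : x ∈ LinearMap.ker (1 - ρ g)) (y : V) : β x y = 0 := by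
  have hx' : ρ g x - x = 0 := by
    rw [← neg_sub]
    exact neg_eq_zero.2 hx
  -- Here x is fixed by g, so only one vector, gy - y, has to be avoided; it is entered twice, and
  -- rank 2 is enough.
  obtain ⟨z, hz⟩ := exists_apply_sub_notMem (u := ρ g y - y) (v := ρ g y - y)
    (n := 1) (by
      rw [Set.pair_eq_singleton, ← Finset.coe_singleton]
      exact finrank_span_finset_le_card _) h
  by_contra h0
  refine hz ((Submodule.smul_mem_iff _ h0).1 ?_)
  rw [Submodule.mem_span_pair]
  refine ⟨-β z x, 0, ?_⟩
  have := hβ x y z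
  rw [hx', smul_zero, zero_add] at this
  rw [eq_neg_of_add_eq_zero_right this, neg_smul, zero_smul, add_zero]

/-- β kills the kernel of 1 - g in both arguments, so it is determined on the image, a plane, where
alternating forms are proportional to ω. -/
theorem form_eq_reflForm (hω_alt : ω.IsAlt) (hω_nondeg : ω.Nondegenerate)
    (hω : ∀ g x y, ω (ρ g x) (ρ g y) = ω x y) (hg : g ∈ symplecticReflections ρ) (hβa : β.IsAlt)
    (hβ : ∀ x y z, β y z • (ρ g x - x) + β z x • (ρ g y - y) +
      β x y • (ρ g z - z) = 0) : ∃ c : ℂ, ∀ x y, β x y = c * reflForm ρ ω g x y := by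
  have hg₁ : Module.finrank ℂ (LinearMap.range (ρ g - 1)) = 2 := hg
  have hg' : Module.finrank ℂ (LinearMap.range (1 - ρ g)) = 2 := by rwa [← range_sub_one]
  obtain ⟨u, hu, v, hv, huv⟩ := reflForm_ne_zero hω_nondeg hω hg
  obtain ⟨c, hc⟩ := exists_eq_mul_of_finrank_eq_two hg' (β := β.restrict _)
    (ω := ω.restrict _) (fun v => hβa.self_eq_zero v) (fun v => hω_alt.self_eq_zero v)
    (fun h => huv (LinearMap.congr_fun₂ h ⟨u, hu⟩ ⟨v, hv⟩))
  have hk : ∀ x y, β x y = β (proj ρ g x) y := by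
    intro x y
    rw [← sub_eq_zero, ← LinearMap.sub_apply, ← map_sub]
    exact form_eq_zero_of_mem_ker hβ hg₁.ge (sub_proj_mem g x) y
  refine ⟨c, fun x y => ?_⟩
  rw [hk, ← hβa.neg_eq, hk, hβa.neg_eq]
  exact hc ⟨_, proj_mem g x⟩ ⟨_, proj_mem g y⟩

end

end

end SRA

/-! ### The Jacobi identity and the explicit form of κ -/

namespace SRA

section

variable {G V : Type*} [Group G] [Finite G] [AddCommGroup V] [Module ℂ V] [FiniteDimensional ℂ V]
  {ω : LinearMap.BilinForm ℂ V} {ρ : Representation ℂ G V}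
  {κ : ⋀[ℂ]^2 V →ₗ[ℂ] MonoidAlgebra ℂ G}

/-- The coefficient of `g` in `κ`. -/
def coeffForm (κ : ⋀[ℂ]^2 V →ₗ[ℂ] MonoidAlgebra ℂ G) (g : G) : LinearMap.BilinForm ℂ V :=
  (bil κ).compr₂ (Finsupp.lapply g ∘ₗ (MonoidAlgebra.coeffLinearEquiv ℂ).toLinearMap)

omit [Group G] [Finite G] [FiniteDimensional ℂ V] in
theorem coeffForm_apply (g : G) (x y : V) : coeffForm κ g x y = (bil κ x y).coeff g := rfl

omit [Finite G] [FiniteDimensional ℂ V] in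
theorem coeffForm_isAlt (g : G) : (coeffForm κ g).IsAlt := fun x => by
  rw [coeffForm_apply, bil_self]
  rfl

omit [FiniteDimensional ℂ V] in
open Classical in
/-- The coefficients of the form of `κ` in the theorem. -/
theorem coeff_form (a : ℂ) (f : symplecticReflections ρ → ℂ) (g : G) :
    (MonoidAlgebra.single 1 a - (2 : ℂ) • ∑ᶠ s : symplecticReflections ρ,
      MonoidAlgebra.single (s : G) (f s)).coeff g =
      (if g = 1 then a else 0) -
        2 * if h : g ∈ symplecticReflections ρ then f ⟨g, h⟩ else 0 := by
  cases nonempty_fintype G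
  rw [finsum_eq_sum_of_fintype, MonoidAlgebra.coeff_sub, MonoidAlgebra.coeff_smul,
    MonoidAlgebra.coeff_sum, Finsupp.sub_apply, Finsupp.smul_apply, Finsupp.finsetSum_apply,
    smul_eq_mul]
  simp only [MonoidAlgebra.coeff_single, Finsupp.single_apply]
  congr 2
  · simp [eq_comm]
  · split_ifs with h
    · rw [Finset.sum_eq_single ⟨g, h⟩]
      · simp
      · intro s _ hs
        rw [if_neg fun h' => hs (Subtype.ext h')]
      · simp
    · refine Finset.sum_eq_zero fun s _ => ?_
      rw [if_neg]
      rintro rfl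
      exact h s.2

omit [Finite G] [FiniteDimensional ℂ V] in
theorem one_notMem_symplecticReflections : (1 : G) ∉ symplecticReflections ρ := by
  intro h
  have h' : Module.finrank ℂ (LinearMap.range (ρ 1 - 1)) = 2 := h
  rw [map_one, sub_self, LinearMap.range_zero, finrank_bot] at h'
  exact two_ne_zero h'.symm

theorem jacobi_of_form (hω_alt : ω.IsAlt) {t : ℂ} {c : symplecticReflections ρ → ℂ}
    (h : ∀ x y : V, κ (wedge x y) = MonoidAlgebra.single 1 (t * ω x y) -
      (2 : ℂ) • ∑ᶠ s : symplecticReflections ρ,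
        MonoidAlgebra.single (s : G) (c s * reflForm ρ ω s x y)) :
    PBW.Jacobi ρ (bil κ) := by
  classical
  intro g x y z
  simp only [bil_apply, h, coeff_form]
  by_cases hg₁ : g = 1
  · subst hg₁
    simp
  by_cases hg : g ∈ symplecticReflections ρ
  · have := congrArg ((-2 * c ⟨g, hg⟩) • ·) (reflForm_cyclic hω_alt hg x y z)
    simp only [smul_zero, smul_add, smul_smul] at this
    simp only [hg₁, hg, if_false, dite_true, zero_sub, ← mul_assoc, ← neg_mul]
    exact this
  · simp [hg₁, hg]

theorem form_of_jacobi (hω_alt : ω.IsAlt) (hω_nondeg : ω.Nondegenerate)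
    (hρ_faithful : Function.Injective ρ)
    (hρ_symplectic : ∀ g x y, ω (ρ g x) (ρ g y) = ω x y)
    (hω_unique : ∀ β : LinearMap.BilinForm ℂ V, β.IsAlt →
      (∀ g x y, β (ρ g x) (ρ g y) = β x y) → ∃ a : ℂ, β = a • ω)
    (hκ_equivariant : ∀ g w, κ (exteriorPower.map 2 (ρ g) w) =
      MonoidAlgebra.single g 1 * κ w * MonoidAlgebra.single g⁻¹ 1)
    (hJ : PBW.Jacobi ρ (bil κ)) :
    ∃ (t : ℂ) (c : symplecticReflections ρ → ℂ),
      (∀ s s' : symplecticReflections ρ, IsConj (s : G) (s' : G) → c s = c s') ∧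
      ∀ x y : V, κ (wedge x y) = MonoidAlgebra.single 1 (t * ω x y) -
        (2 : ℂ) • ∑ᶠ s : symplecticReflections ρ,
          MonoidAlgebra.single (s : G) (c s * reflForm ρ ω s x y) := by
  classical
  have hconj : ∀ g h x y, coeffForm κ (g * h * g⁻¹) (ρ g x) (ρ g y) = coeffForm κ h x y :=
    fun g h x y => bil_coeff_conj ρ κ hκ_equivariant g h x y
  obtain ⟨t, ht⟩ := hω_unique (coeffForm κ 1) (coeffForm_isAlt 1) fun g x y => by
    simpa using hconj g 1 x y
  have hS : ∀ s : symplecticReflections ρ, ∃ c : ℂ, ∀ x y,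
      coeffForm κ s x y = c * reflForm ρ ω s x y := fun s =>
    form_eq_reflForm hω_alt hω_nondeg hρ_symplectic s.2 (coeffForm_isAlt _) (hJ s)
  choose c hc using hS
  -- Dividing by -2 absorbs the factor in front of the sum.
  refine ⟨t, fun s => -c s / 2, fun s s' hss' => ?_, fun x y => ?_⟩
  · obtain ⟨g, hg⟩ := isConj_iff.1 hss'
    -- On a pair where ω_s does not vanish, equivariance of κ and of ω_s lets the two constants be
    -- compared.
    obtain ⟨u, hu, v, hv, huv⟩ := reflForm_ne_zero hω_nondeg hρ_symplectic s.2
    have h₁ := hconj g s u v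
    rw [hg, hc, hc, ← hg, reflForm_conj hρ_symplectic] at h₁
    have h₂ : reflForm ρ ω s u v ≠ 0 := by
      change ω (proj ρ s u) (proj ρ s v) ≠ 0
      rwa [proj_eq_of_mem hu, proj_eq_of_mem hv]
    change -c s / 2 = -c s' / 2
    rw [mul_right_cancel₀ h₂ h₁]
  · apply MonoidAlgebra.coeff_injective
    ext g
    rw [coeff_form]
    change coeffForm κ g x y = _
    by_cases hg₁ : g = 1
    · subst hg₁
      rw [ht, dif_neg one_notMem_symplecticReflections, if_pos rfl, mul_zero, sub_zero]
      rfl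
    rw [if_neg hg₁]
    by_cases hg : g ∈ symplecticReflections ρ
    · rw [dif_pos hg, hc ⟨g, hg⟩]
      ring
    · rw [dif_neg hg, mul_zero, sub_zero]
      have hg' : ρ g ≠ 1 := fun h => hg₁ (hρ_faithful (h.trans (map_one ρ).symm))
      have h2 := two_le_finrank_range hω_alt hω_nondeg hρ_symplectic hg'
      have h3 : 3 ≤ Module.finrank ℂ (LinearMap.range (ρ g - 1)) :=
        lt_of_le_of_ne h2 fun h => hg h.symm
      have h0 : coeffForm κ g = 0 := form_eq_zero_of_three_le (hJ g) h3
      rw [h0]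
      rfl

theorem xi_injective_of_jacobi (hκ_equivariant : ∀ g w, κ (exteriorPower.map 2 (ρ g) w) =
      MonoidAlgebra.single g 1 * κ w * MonoidAlgebra.single g⁻¹ 1)
    (hJ : PBW.Jacobi ρ (bil κ)) : Function.Injective (xi ρ κ) := by
  cases nonempty_fintype G
  -- A basis indexed by `Fin` supplies the linear order on letters.
  exact xi_injective_of_relAt (b := Module.finBasis ℂ V)
    (PBW.relAt (bil_self κ) hJ (bil_equivariant ρ κ hκ_equivariant))

end

end SRA

end

theorem mainTheorem1 {G V : Type*} [Group G] [Finite G]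
    [AddCommGroup V] [Module ℂ V] [FiniteDimensional ℂ V]
    (ω : LinearMap.BilinForm ℂ V) (hω_alt : ω.IsAlt) (hω_nondeg : ω.Nondegenerate)
    (ρ : Representation ℂ G V) (hρ_faithful : Function.Injective ρ)
    (hρ_symplectic : ∀ g x y, ω (ρ g x) (ρ g y) = ω x y)
    (hω_unique : ∀ β : LinearMap.BilinForm ℂ V, β.IsAlt →
      (∀ g x y, β (ρ g x) (ρ g y) = β x y) → ∃ a : ℂ, β = a • ω)
    (κ : ⋀[ℂ]^2 V →ₗ[ℂ] MonoidAlgebra ℂ G)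
    (hκ_equivariant : ∀ g w, κ (exteriorPower.map 2 (ρ g) w) =
      MonoidAlgebra.single g 1 * κ w * MonoidAlgebra.single g⁻¹ 1) :
    Function.Surjective (SRA.xi ρ κ) ∧
    (Function.Bijective (SRA.xi ρ κ) ↔
      ∃ (t : ℂ) (c : SRA.symplecticReflections ρ → ℂ),
        (∀ s s' : SRA.symplecticReflections ρ, IsConj (s : G) (s' : G) → c s = c s') ∧
        ∀ x y : V, κ (SRA.wedge x y) =
          MonoidAlgebra.single 1 (t * ω x y) -
            (2 : ℂ) • ∑ᶠ s : SRA.symplecticReflections ρ,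
              MonoidAlgebra.single (s : G) (c s * SRA.reflForm ρ ω s x y)) := by
  refine ⟨SRA.xi_surjective ρ κ, fun h => ?_, ?_⟩
  · cases nonempty_fintype G
    exact SRA.form_of_jacobi hω_alt hω_nondeg hρ_faithful hρ_symplectic hω_unique hκ_equivariant
      (SRA.jacobi_of_xi_injective ρ κ h.injective)
  · rintro ⟨t, c, -, h⟩
    exact ⟨SRA.xi_injective_of_jacobi hκ_equivariant (SRA.jacobi_of_form hω_alt h),
      SRA.xi_surjective ρ κ⟩
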